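/- Let $G$ be a group and let $K$ be an uncountable algebraically closed field. Let $X$ be an algebraic group over $K$, that is, a group object in the category of $K$-schemes that is reduced and of finite type over $K$ (not necessarily affine, connected or commutative). Put $A = X(K)$, with neutral element $e$. For finite $\Omega \subset G$, identify $A^\Omega$ with $X^\Omega(K)$, where $X^\Omega$ is the fibred product over $K$ of copies of $X$ indexed by $\Omega$, and give it the Zariski topology; $\dim$ denotes Krull dimension for this topology. For $D \subset A^\Omega$ let $D_e = D \times \{e\}^{G \setminus \Omega} \subset A^G$. A subset of $A^G$ contained in $(A^F)_e$ for some finite $F \subset G$ has a dimension as a subset of $(A^F)_e = A^F$, and this does not depend on $F$. For $g \in G$ and $c \in A^G$ let $(gc)(h) = c(g^{-1}h)$ for $h \in G$. Let $CA_{algr}(G,X,K)$ be the set of maps $\tau \colon A^G \to A^G$ for which there are a finite set $M \subset G$ and a homomorphism of algebraic groups $f \colon X^M \to X$ such that $\tau(c)(g) = f((g^{-1}c)|_M)$ for all $c \in A^G$ and $g \in G$. Two configurations in $A^G$ are asymptotic if they agree outside a finite subset of $G$. A map $\tau \colon A^G \to A^G$ is post-surjective if for all $x, y \in A^G$ with $y$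 asymptotic to $\tau(x)$ there is $z \in A^G$ asymptotic to $x$ with $\tau(z) = y$. The group $G$ is sofic if for every finite $F \subset G$ and every $\varepsilon > 0$ there are a nonempty finite set $V$ and a map $\varphi \colon G \to \mathrm{Sym}(V)$ such that $|\{v \in V : \varphi(gh)(v) \neq \varphi(g)(\varphi(h)(v))\}| \le \varepsilon |V|$ for all $g,h \in F$, and $|\{v \in V : \varphi(g)(v) \ne \varphi(h)(v)\}| \ge (1-\varepsilon)|V|$ for all distinct $g,h \in F$. **Theorem (dual surjunctivity for algebraic group cellular automata).** Suppose that $G$ is sofic and that $\tau \in CA_{algr}(G,X,K)$ is post-surjective. Then: 1. $\tau$ is $(\bullet)$-pre-injective: there do not exist a finite subset $\Omega \subset G$ and a Zariski closed subset $H \subsetneq A^\Omega$ such that $\tau((A^\Omega)_e) = \tau(H_e)$; 2. $\tau$ is $(\bullet\bullet)$-pre-injective: $\dim \tau((A^\Omega)_e) = \dim A^\Omega$ for every finite subset $\Omega \subset G$. -/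

import Mathlib

open CategoryTheory CategoryTheory.Limits AlgebraicGeometry
open scoped Topology

attribute [local instance] CategoryTheory.Hom.group

universe u v

/-- A group `G` is sofic if for every finite `F ⊆ G` and every `ε > 0` there are a nonempty finite
set `V` (here `Fin n` with `n > 0`) and a map `φ` from `G` to the permutations of `V` such that,
for the normalized Hamming distance on permutations of `V`, the permutations `φ (g h)` and
`φ g ∘ φ h` are at distance at most `ε` for `g, h ∈ F`, and `φ g` and `φ h` are at distance at
least `1 - ε` for distinct `g, h ∈ F`. -/
def IsSofic (G : Type v) [Group G] : Prop :=
  ∀ (F : Finset G) (ε : ℝ), 0 < ε →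
    ∃ n : ℕ, 0 < n ∧ ∃ φ : G → Equiv.Perm (Fin n),
      (∀ g ∈ F, ∀ h ∈ F,
        ((Finset.univ.filter fun v => φ (g * h) v ≠ φ g (φ h v)).card : ℝ) ≤ ε * n) ∧
      (∀ g ∈ F, ∀ h ∈ F, g ≠ h →
        (1 - ε) * n ≤ ((Finset.univ.filter fun v => φ g v ≠ φ h v).card : ℝ))

section Configurations

variable {G : Type v} [Group G] {A : Type u}

/-- The Bernoulli shift: `(g c)(h) = c (g⁻¹ h)`. -/
def shift (g : G) (c : G → A) : G → A := fun h => c (g⁻¹ * h)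

/-- `τ` is the cellular automaton with finite memory set `M` and local defining map `μ`:
`τ(c)(g) = μ((g⁻¹ c)|_M)`. -/
def IsCAWith (τ : (G → A) → (G → A)) (M : Finset G) (μ : (M → A) → A) : Prop :=
  ∀ (c : G → A) (g : G), τ c g = μ fun m => shift g⁻¹ c m

/-- Two configurations are asymptotic if they agree outside a finite subset of `G`. -/
def Asymptotic (c d : G → A) : Prop := ∃ E : Finset G, ∀ g, g ∉ E → c g = d g

/-- Post-surjectivity. -/
def PostSurjective (τ : (G → A) → (G → A)) : Prop :=
  ∀ x y : G → A, Asymptotic y (τ x) → ∃ z : G → A, Asymptotic z x ∧ τ z = y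

open Classical in
/-- For finite `Ω ⊆ G` and `p ∈ A^Ω`, the configuration equal to `p` on `Ω` and to the neutral
element elsewhere. Hence for `D ⊆ A^Ω`, the set `D_e = D × {e}^(G ∖ Ω)` is `extendByOne Ω '' D`. -/
noncomputable def extendByOne [One A] (Ω : Finset G) (p : Ω → A) : G → A :=
  fun g => if h : g ∈ Ω then p ⟨g, h⟩ else 1

end Configurations

section AlgebraicGroups

variable {K : Type u} [Field K]

/-- The set `X(K)` of `K`-points of a `K`-scheme `X`. -/
abbrev Pts (X : Over (Spec (.of K))) : Type u := Over.mk (𝟙 (Spec (.of K))) ⟶ X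

/-- The fibre product over `K` of copies of `X` indexed by a finite type `ι`. -/
noncomputable abbrev power (X : Over (Spec (.of K))) (ι : Type v) [Finite ι] :
    Over (Spec (.of K)) :=
  ∏ᶜ fun _ : ι => X

/-- The `K`-point of `X^ι` with given coordinates; this is the identification
`X(K)^ι = X^ι(K)`. -/
noncomputable abbrev toPower {X : Over (Spec (.of K))} {ι : Type v} [Finite ι] (p : ι → Pts X) :
    Pts (power X ι) :=
  Pi.lift p

/-- The Zariski topology on `X(K)^ι = X^ι(K)`: the one induced by the topology of the scheme `X^ι`
when a `K`-point is identified with its image in `X^ι`. -/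
noncomputable abbrev zariskiTopology (X : Over (Spec (.of K))) (ι : Type v) [Finite ι] :
    TopologicalSpace (ι → Pts X) :=
  TopologicalSpace.induced
    (fun p => (toPower p).left (IsLocalRing.closedPoint K)) inferInstance

/-- The Krull dimension of a subset of `X(K)^ι` for the Zariski topology. -/
noncomputable def zariskiDim {X : Over (Spec (.of K))} {ι : Type v} [Finite ι]
    (S : Set (ι → Pts X)) : WithBot ℕ∞ :=
  letI := zariskiTopology X ι
  topologicalKrullDim S

/-- A morphism of `K`-schemes `X^ι → X` is a homomorphism of algebraic groups if for every
`K`-scheme `T` the induced map `X(T)^ι → X(T)` is a homomorphism of groups, where `X(T)^ι` has the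
componentwise multiplication. -/
def IsAlgGroupHom {X : Over (Spec (.of K))} [GrpObj X] {ι : Type v} [Finite ι]
    (f : power X ι ⟶ X) : Prop :=
  ∀ (T : Over (Spec (.of K))) (a b : ι → (T ⟶ X)),
    (Pi.lift fun i => a i * b i) ≫ f = (Pi.lift a ≫ f) * (Pi.lift b ≫ f)

variable {G : Type v} [Group G] {X : Over (Spec (.of K))} [GrpObj X]

/-- The class `CA_algr(G, X, K)`: cellular automata over the alphabet `X(K)` admitting a finite
memory set `M` and a local defining map induced by a homomorphism of algebraic groups
`X^M → X`. -/
def IsAlgGroupCA (τ : (G → Pts X) → (G → Pts X)) : Prop :=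
  ∃ (M : Finset G) (f : power X M ⟶ X), IsAlgGroupHom f ∧
    IsCAWith τ M fun p => toPower p ≫ f

/-- (•)-pre-injectivity: there are no finite `Ω ⊆ G` and Zariski closed `H ⊊ A^Ω` with
`τ((A^Ω)_e) = τ(H_e)`. -/
def OneBulletPreInjective (τ : (G → Pts X) → (G → Pts X)) : Prop :=
  ¬ ∃ (Ω : Finset G) (H : Set (Ω → Pts X)),
    IsClosed[zariskiTopology X Ω] H ∧ H ≠ Set.univ ∧
      τ '' (extendByOne Ω '' Set.univ) = τ '' (extendByOne Ω '' H)

/-- A set `S` of configurations has dimension `d`: it lies in `(A^F)_e` for some finite `F ⊆ G`,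
and for each such `F` its Krull dimension as a subset of `A^F = (A^F)_e`, for the Zariski
topology, is `d`. -/
def HasDim (S : Set (G → Pts X)) (d : WithBot ℕ∞) : Prop :=
  (∃ F : Finset G, S ⊆ Set.range (extendByOne F)) ∧
    ∀ F : Finset G, S ⊆ Set.range (extendByOne F) →
      zariskiDim {p : F → Pts X | extendByOne F p ∈ S} = d

/-- (••)-pre-injectivity: `dim τ((A^Ω)_e) = dim A^Ω` for every finite `Ω ⊆ G`. -/
def TwoBulletPreInjective (τ : (G → Pts X) → (G → Pts X)) : Prop :=
  ∀ Ω : Finset G,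
    HasDim (τ '' (extendByOne Ω '' Set.univ)) (zariskiDim (Set.univ : Set (Ω → Pts X)))

end AlgebraicGroups

/-! The map τ is a homomorphism (`caHom`), so both claims concern the kernel N of τ on the patterns
A^Ω. It suffices that N is finite and lies in the identity component of A^Ω. A homomorphism of this
kind with finite kernel preserves dimension (`topologicalKrullDim_le_range`,
`topologicalKrullDim_range_le`), which is (••). For (•), a closed H with the same image as A^Ω meets
every coset of N. Each irreducible component is then covered by finitely many translates of H, hence
lies in one of them; since N preserves the components, H is everything
(`IsClosed.eq_univ_of_forall_exists_mul_mem`).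

Post-surjectivity enters through uniformity (`exists_finset_forall_caHom_eq_mulSingle`). The letters
which, placed at 1, have a preimage supported in a given finite set form a closed subgroup of A.
Only the countable subgroup generated by the memory set matters, so an increasing sequence of such
subgroups covers A. As K is uncountable and algebraically closed, one of them is A.

Soficity enters through a count (`not_isLargeIndex_card_ker`). On a sofic approximation with n
vertices τ has an analogue Φ on A^n. By uniformity its image contains all functions supported on
good vertices. If N were large, disjoint copies of Ω would give a chain of subgroups in ker Φ of
length proportional to n. Chain length adds up along homomorphisms (`HasChain.add`,
`HasChain.exists_add`) and is at most d·n on A^n, where d is the maximum for A. As nearly all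
vertices are good, this is a contradiction.

The count is used twice. With closed subgroups and infinite indices, where d is bounded by dim A, it
shows that N is finite. With all subgroups of the finite group A/A° and proper inclusions, A° being
the identity component, it shows that the elements of N have all their values in A°. -/

/-! ### Identity components of Noetherian groups with continuous translations -/

section NoetherianGroups

open TopologicalSpace

variable {B : Type*} [Group B] [TopologicalSpace B] [SeparatelyContinuousMul B]
  [NoetherianSpace B]

/-- In a homogeneous Noetherian space, every point lies on a unique irreducible component. -/
theorem IsIrreducible.subset_irreducibleComponent_of_mem {Z : Set B} (hZ : IsIrreducible Z)
    {x : B} (hx : x ∈ Z) : Z ⊆ irreducibleComponent x := by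
  have hC := irreducibleComponent_mem_irreducibleComponents x
  obtain ⟨o, ho, ⟨y, hy⟩, hoC⟩ :=
    NoetherianSpace.exists_isOpen_nonempty_subset_irreducibleComponent _ hC
  -- This translation moves `x` to a point `y` with a neighbourhood inside one component. An
  -- irreducible set through `y` lies in the closure of its trace on that neighbourhood, hence in
  -- that component.
  let h : B ≃ₜ B := Homeomorph.mulLeft (y * x⁻¹)
  have hxy : h x = y := by simp [h]
  have key : ∀ S : Set B, IsPreirreducible S → x ∈ S →
      S ⊆ h ⁻¹' irreducibleComponent x := by
    intro S hS hxS
    have h1 : IsPreirreducible (h '' S) := hS.image h h.continuous.continuousOn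
    have h2 := subset_closure_inter_of_isPreirreducible_of_isOpen h1 ho
      ⟨y, ⟨x, hxS, hxy⟩, hy⟩
    rw [← Set.image_subset_iff]
    exact h2.trans (closure_minimal (Set.inter_subset_right.trans hoC)
      isClosed_irreducibleComponent)
  have hirr : IsPreirreducible (h ⁻¹' irreducibleComponent x) :=
    isIrreducible_irreducibleComponent.isPreirreducible.preimage h.isOpenEmbedding
  have heq := eq_irreducibleComponent hirr
    (key _ isIrreducible_irreducibleComponent.isPreirreducible mem_irreducibleComponent)
  exact (key Z hZ.isPreirreducible hx).trans heq.le

theorem irreducibleComponent_eq_of_mem {x y : B} (h : y ∈ irreducibleComponent x) :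
    irreducibleComponent x = irreducibleComponent y :=
  (eq_irreducibleComponent (x := x)
    isIrreducible_irreducibleComponent.isPreirreducible
    (isIrreducible_irreducibleComponent.subset_irreducibleComponent_of_mem h)).symm

theorem Homeomorph.image_irreducibleComponent (h : B ≃ₜ B) (x : B) :
    h '' irreducibleComponent x = irreducibleComponent (h x) := by
  apply Set.Subset.antisymm
  · exact (isIrreducible_irreducibleComponent.image h h.continuous.continuousOn
      ).subset_irreducibleComponent_of_mem ⟨x, mem_irreducibleComponent, rfl⟩
  · have := (isIrreducible_irreducibleComponent (x := h x)).image h.symm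
      h.symm.continuous.continuousOn
    have := this.subset_irreducibleComponent_of_mem (x := x)
      ⟨h x, mem_irreducibleComponent, by simp⟩
    intro y hy
    exact ⟨h.symm y, this ⟨y, hy, rfl⟩, by simp⟩

variable (B) in
/-- The irreducible component of the neutral element. -/
def identityComponent : Subgroup B where
  carrier := irreducibleComponent 1
  one_mem' := mem_irreducibleComponent
  mul_mem' {a b} ha hb := by
    have h := (Homeomorph.mulLeft a).image_irreducibleComponent 1
    simp only [Homeomorph.coe_mulLeft, mul_one] at h
    rw [irreducibleComponent_eq_of_mem ha, ← h]
    exact ⟨b, hb, rfl⟩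
  inv_mem' {a} ha := by
    have h := (Homeomorph.mulLeft a⁻¹).image_irreducibleComponent a
    simp only [Homeomorph.coe_mulLeft, inv_mul_cancel] at h
    rw [← h]
    exact ⟨1, by
      rw [← irreducibleComponent_eq_of_mem ha]; exact mem_irreducibleComponent, by simp⟩

theorem isClosed_identityComponent : IsClosed (identityComponent B : Set B) :=
  isClosed_irreducibleComponent

theorem isIrreducible_identityComponent : IsIrreducible (identityComponent B : Set B) :=
  isIrreducible_irreducibleComponent

theorem IsIrreducible.subset_identityComponent {Z : Set B} (hZ : IsIrreducible Z)
    (h1 : (1 : B) ∈ Z) : Z ⊆ identityComponent B :=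
  hZ.subset_irreducibleComponent_of_mem h1

theorem image_mul_identityComponent (a : B) :
    (fun x => a * x) '' (identityComponent B : Set B) = irreducibleComponent a := by
  have h := (Homeomorph.mulLeft a).image_irreducibleComponent 1
  rw [Homeomorph.coe_mulLeft] at h
  exact h.trans (congrArg _ (mul_one a))

instance identityComponent_normal : (identityComponent B).Normal where
  conj_mem n hn g := by
    have h := ((Homeomorph.mulRight g⁻¹).trans
      (Homeomorph.mulLeft g)).image_irreducibleComponent 1
    have h2 : (((Homeomorph.mulRight g⁻¹).trans (Homeomorph.mulLeft g)) (1 : B)) = 1 := by simp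
    rw [h2] at h
    change g * n * g⁻¹ ∈ irreducibleComponent (1 : B)
    rw [← h]
    exact ⟨n, hn, by simp [mul_assoc]⟩

instance identityComponent_finiteIndex : (identityComponent B).FiniteIndex := by
  have hfin := NoetherianSpace.finite_irreducibleComponents (α := B)
  have := hfin.to_subtype
  let F : B ⧸ identityComponent B → irreducibleComponents B :=
    fun q => ⟨irreducibleComponent q.out, irreducibleComponent_mem_irreducibleComponents _⟩
  have hF : Function.Injective F := by
    intro q r h
    have h' : irreducibleComponent q.out = irreducibleComponent r.out := congrArg Subtype.val h
    have : r.out ∈ irreducibleComponent q.out := h' ▸ mem_irreducibleComponent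
    rw [← image_mul_identityComponent] at this
    obtain ⟨x, hx, hxr⟩ := this
    rw [← q.out_eq, ← r.out_eq]
    apply QuotientGroup.eq.mpr
    rw [← hxr]
    simpa using hx
  have := Finite.of_injective F hF
  exact Subgroup.finiteIndex_of_finite_quotient

/-- A closed subgroup contains an irreducible closed subgroup of finite index that contains every
irreducible subset through the neutral element. -/
theorem exists_identityComponent_of_isClosed {Q : Subgroup B} (hQ : IsClosed (Q : Set B)) :
    ∃ R : Subgroup B, R ≤ Q ∧ IsClosed (R : Set B) ∧ IsIrreducible (R : Set B) ∧
      R.relIndex Q ≠ 0 ∧ ∀ Z : Set B, IsIrreducible Z → (1 : B) ∈ Z → Z ⊆ Q → Z ⊆ R := by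
  have : SeparatelyContinuousMul Q :=
    inferInstanceAs (SeparatelyContinuousMul Q.toSubmonoid)
  have : NoetherianSpace Q := NoetherianSpace.set (Q : Set B)
  refine ⟨(identityComponent Q).map Q.subtype, ?_, ?_, ?_, ?_, ?_⟩
  · exact Subgroup.map_subtype_le _
  · exact hQ.isClosedMap_subtype_val _ isClosed_identityComponent
  · exact isIrreducible_identityComponent.image _ continuous_subtype_val.continuousOn
  · have h := (identityComponent Q).relIndex_top_right
    rw [Subgroup.relIndex, Subgroup.subgroupOf,
      Subgroup.comap_map_eq_self_of_injective Q.subtype_injective]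
    exact Subgroup.FiniteIndex.index_ne_zero
  · intro Z hZ h1 hZQ z hz
    have hirr : IsIrreducible ((↑) ⁻¹' Z : Set Q) := by
      refine ⟨⟨1, h1⟩, ?_⟩
      rintro U V hU hV ⟨x, hxZ, hxU⟩ ⟨y, hyZ, hyV⟩
      obtain ⟨U', hU', rfl⟩ := hU
      obtain ⟨V', hV', rfl⟩ := hV
      obtain ⟨w, hwZ, hw⟩ := hZ.2 U' V' hU' hV' ⟨x, hxZ, hxU⟩ ⟨y, hyZ, hyV⟩
      exact ⟨⟨w, hZQ hwZ⟩, hwZ, hw⟩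
    exact ⟨⟨z, hZQ hz⟩, hirr.subset_identityComponent h1 hz, rfl⟩

end NoetherianGroups

/-! ### Closed images of closed subgroups -/

section ImagesOfClosedSubgroups

/-- Images of irreducible closed sets contain a nonempty relatively open subset of their
closure. -/
def IsChevalleyMap {B C : Type*} [TopologicalSpace B] [TopologicalSpace C] (f : B → C) : Prop :=
  ∀ Z : Set B, IsClosed Z → IsIrreducible Z →
    ∃ U : Set C, IsOpen U ∧ (U ∩ f '' Z).Nonempty ∧ U ∩ closure (f '' Z) ⊆ f '' Z

variable {C : Type*} [Group C] [TopologicalSpace C] [SeparatelyContinuousMul C] [ContinuousInv C]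

/-- A subgroup with irreducible closure that contains a nonempty open subset of its closure is
closed. -/
theorem Subgroup.isClosed_of_isIrreducible_of_isOpen {H : Subgroup C}
    (hH : IsIrreducible (H : Set C)) {U : Set C} (hU : IsOpen U) (hne : (U ∩ H).Nonempty)
    (hsub : U ∩ _root_.closure (H : Set C) ⊆ H) : IsClosed (H : Set C) := by
  have hmul : ∀ a ∈ _root_.closure (H : Set C), ∀ b ∈ _root_.closure (H : Set C),
      a * b ∈ _root_.closure (H : Set C) :=
    fun a ha b hb => H.toSubmonoid.topologicalClosure.mul_mem ha hb
  have hinv : ∀ a ∈ _root_.closure (H : Set C), a⁻¹ ∈ _root_.closure (H : Set C) := by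
    intro a ha
    exact map_mem_closure continuous_inv ha fun x hx => H.inv_mem hx
  refine isClosed_of_closure_subset fun x hx => ?_
  obtain ⟨u, huU, huH⟩ := hne
  have hcl : IsIrreducible (_root_.closure (H : Set C)) := isIrreducible_iff_closure.mpr hH
  -- Both `U` and its translate by `x` meet the irreducible closure, so they meet inside it at some
  -- `w`; then `w` and `x⁻¹ * w` lie in `H`, and so does `x`.
  obtain ⟨w, hw, hwU, hwx⟩ := hcl.2 U ((fun c => x⁻¹ * c) ⁻¹' U) hU
    (hU.preimage (continuous_const_mul _)) ⟨u, _root_.subset_closure huH, huU⟩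
    ⟨x * u, hmul x hx u (_root_.subset_closure huH), by simpa using huU⟩
  have h1 : w ∈ H := hsub ⟨hwU, hw⟩
  have h2 : x⁻¹ * w ∈ H := hsub ⟨hwx, hmul _ (hinv x hx) _ hw⟩
  have := H.mul_mem h1 (H.inv_mem h2)
  simpa using this

variable {B : Type*} [Group B] [TopologicalSpace B] [SeparatelyContinuousMul B]
  [TopologicalSpace.NoetherianSpace B]

/-- The irreducible case applies to the identity component of `Q`, which has finite index; the image
of `Q` is a finite union of translates of its image. -/
theorem IsChevalleyMap.isClosed_map {φ : B →* C} (hφ : IsChevalleyMap φ) (hc : Continuous φ)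
    {Q : Subgroup B} (hQ : IsClosed (Q : Set B)) : IsClosed (Q.map φ : Set C) := by
  obtain ⟨R, hRQ, hRcl, hRirr, hRfin, -⟩ := exists_identityComponent_of_isClosed hQ
  obtain ⟨U, hU, hne, hsub⟩ := hφ R hRcl hRirr
  have hR : IsClosed (R.map φ : Set C) :=
    Subgroup.isClosed_of_isIrreducible_of_isOpen
      (hRirr.image φ hc.continuousOn) hU hne hsub
  have hfin : (R.subgroupOf Q).FiniteIndex := ⟨hRfin⟩
  have : (Q.map φ : Set C) =
      ⋃ q : Q ⧸ R.subgroupOf Q, (fun c => (φ q.out)⁻¹ * c) ⁻¹' (R.map φ : Set C) := by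
    ext c
    simp only [Subgroup.coe_map, Set.mem_image, SetLike.mem_coe, Set.mem_iUnion, Set.mem_preimage]
    constructor
    · rintro ⟨x, hx, rfl⟩
      refine ⟨QuotientGroup.mk ⟨x, hx⟩, ((QuotientGroup.mk (s := R.subgroupOf Q)
        (⟨x, hx⟩ : Q)).out : B)⁻¹ * x, ?_, by simp⟩
      have h := QuotientGroup.eq.mp (QuotientGroup.out_eq' (QuotientGroup.mk (s := R.subgroupOf Q)
        (⟨x, hx⟩ : Q)))
      exact h
    · rintro ⟨q, r, hr, h⟩
      exact ⟨q.out * r, Q.mul_mem q.out.2 (hRQ hr), by simp [h]⟩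
  rw [this]
  exact isClosed_iUnion_of_finite fun q => hR.preimage (continuous_const_mul _)

end ImagesOfClosedSubgroups

/-! ### Chains of subgroups as a substitute for dimension and for the logarithm of cardinality -/

section Chains

/-- An index (with `0` encoding infinity) is large if it is infinite or, in the strict case,
different from `1`. -/
def IsLargeIndex (strict : Prop) (n : ℕ) : Prop := n = 0 ∨ strict ∧ n ≠ 1

theorem IsLargeIndex.of_mul {s : Prop} {a b : ℕ} (h : IsLargeIndex s (a * b)) :
    IsLargeIndex s a ∨ IsLargeIndex s b := by
  rcases h with h | ⟨hs, h⟩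
  · rcases mul_eq_zero.mp h with h | h
    · exact Or.inl (Or.inl h)
    · exact Or.inr (Or.inl h)
  · by_cases ha : a = 1
    · exact Or.inr (Or.inr ⟨hs, fun hb => h (by rw [ha, hb])⟩)
    · exact Or.inl (Or.inr ⟨hs, ha⟩)

variable {B C : Type*} [Group B] [Group C]

theorem IsLargeIndex.mono_right {s : Prop} {H K L : Subgroup B} (hKL : K ≤ L)
    (h : IsLargeIndex s (H.relIndex K)) : IsLargeIndex s (H.relIndex L) := by
  rcases h with h | ⟨hs, h⟩
  · exact Or.inl (Subgroup.relIndex_eq_zero_of_le_right hKL h)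
  · exact Or.inr ⟨hs, fun h' => h (Subgroup.relIndex_eq_one.mpr
      (hKL.trans (Subgroup.relIndex_eq_one.mp h')))⟩

/-- A coset form of the second isomorphism theorem, with no normality of `P`: if x = p k with k in
the kernel, then x = (p k p⁻¹) p, so p k p⁻¹ represents the left coset of x and lies in `Q ⊓ φ.ker`.
-/
theorem Subgroup.relIndex_sup_inf_ker (φ : B →* C) {P Q : Subgroup B} (hPQ : P ≤ Q) :
    P.relIndex ((P ⊔ φ.ker) ⊓ Q) = (P ⊓ φ.ker).relIndex (Q ⊓ φ.ker) := by
  have hle : Q ⊓ φ.ker ≤ (P ⊔ φ.ker) ⊓ Q := le_inf (inf_le_right.trans le_sup_right) inf_le_left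
  have h1 : (P ⊓ φ.ker).relIndex (Q ⊓ φ.ker) = P.relIndex (Q ⊓ φ.ker) := by
    rw [← Subgroup.inf_relIndex_right P (Q ⊓ φ.ker), ← Subgroup.inf_relIndex_right (P ⊓ φ.ker)]
    congr 1
    ext x; simp only [Subgroup.mem_inf]; tauto
  rw [h1]
  symm
  refine Nat.card_congr (Equiv.ofBijective (Quotient.map' (Subgroup.inclusion hle) ?_) ⟨?_, ?_⟩)
  · intro a b hab
    rw [QuotientGroup.leftRel_apply] at hab ⊢
    exact hab
  · intro a b
    induction a using Quotient.inductionOn'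
    induction b using Quotient.inductionOn'
    intro h
    rw [Quotient.map'_mk'', Quotient.map'_mk''] at h
    have h' := QuotientGroup.eq.mp h
    exact QuotientGroup.eq.mpr h'
  · intro q
    induction q using Quotient.inductionOn' with | h x =>
    obtain ⟨x, hx⟩ := x
    obtain ⟨hx1, hx2⟩ := Subgroup.mem_inf.mp hx
    obtain ⟨p, hp, k, hk, hpk⟩ := Subgroup.mem_sup_of_normal_right.mp hx1
    have hk' : p * k * p⁻¹ ∈ φ.ker := (MonoidHom.normal_ker φ).conj_mem k hk p
    have hkQ : p * k * p⁻¹ ∈ Q := by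
      rw [hpk]; exact Q.mul_mem hx2 (Q.inv_mem (hPQ hp))
    refine ⟨Quotient.mk'' ⟨p * k * p⁻¹, hkQ, hk'⟩, ?_⟩
    rw [Quotient.map'_mk'']
    apply QuotientGroup.eq.mpr
    change (p * k * p⁻¹)⁻¹ * x ∈ P
    rw [← hpk]
    simpa [mul_assoc] using hp

/-- The inclusion of `P` in `Q` factors through `(P ⊔ φ.ker) ⊓ Q`: the lower index is visible in the
kernel, the upper one in the image. -/
theorem Subgroup.relIndex_eq_mul_of_hom (φ : B →* C) {P Q : Subgroup B} (hPQ : P ≤ Q) :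
    P.relIndex Q =
      (P ⊓ φ.ker).relIndex (Q ⊓ φ.ker) * (P.map φ).relIndex (Q.map φ) := by
  rw [← Subgroup.relIndex_comap, Subgroup.comap_map_eq, ← Subgroup.relIndex_sup_inf_ker φ hPQ,
    Subgroup.relIndex_inf_mul_relIndex]
  congr 1
  exact (inf_eq_left.mpr (le_sup_left : P ≤ P ⊔ φ.ker)).symm

/-- `HasChain s adm k Q`: there is a chain of length `k` of admissible subgroups that ends in `Q`
and in which all relative indices are large. -/
def HasChain (s : Prop) (adm : Subgroup B → Prop) : ℕ → Subgroup B → Prop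
  | 0, _ => True
  | k + 1, Q => ∃ P ≤ Q, adm P ∧ IsLargeIndex s (P.relIndex Q) ∧ HasChain s adm k P

variable {s : Prop} {adm : Subgroup B → Prop} {adm' : Subgroup C → Prop}

theorem HasChain.mono {k : ℕ} {P Q : Subgroup B} (hPQ : P ≤ Q) (h : HasChain s adm k P) :
    HasChain s adm k Q := by
  cases k with
  | zero => trivial
  | succ k =>
    obtain ⟨R, hR, hadm, hl, hc⟩ := h
    exact ⟨R, hR.trans hPQ, hadm, hl.mono_right hPQ, hc⟩

/-- The chain length is subadditive along homomorphisms. -/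
theorem HasChain.exists_add (φ : B →* C) (hker : ∀ P, adm P → adm (P ⊓ φ.ker))
    (hmap : ∀ P, adm P → adm' (P.map φ)) {k : ℕ} {Q : Subgroup B} (h : HasChain s adm k Q) :
    ∃ a b, a + b = k ∧ HasChain s adm a (Q ⊓ φ.ker) ∧ HasChain s adm' b (Q.map φ) := by
  induction k generalizing Q with
  | zero => exact ⟨0, 0, rfl, trivial, trivial⟩
  | succ k ih =>
    obtain ⟨P, hP, hadm, hl, hc⟩ := h
    obtain ⟨a, b, hab, ha, hb⟩ := ih hc
    rw [Subgroup.relIndex_eq_mul_of_hom φ hP] at hl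
    -- A large product has a large factor, so each link of the chain survives in the kernel or in
    -- the image.
    rcases hl.of_mul with hl | hl
    · exact ⟨a + 1, b, by omega, ⟨_, inf_le_inf_right _ hP, hker P hadm, hl, ha⟩,
        hb.mono (Subgroup.map_mono hP)⟩
    · exact ⟨a, b + 1, by omega, ha.mono (inf_le_inf_right _ hP),
        ⟨_, Subgroup.map_mono hP, hmap P hadm, hl, hb⟩⟩

/-- The chain length is superadditive along homomorphisms. -/
theorem HasChain.add (φ : B →* C) (hinf : ∀ P Q, adm P → adm Q → adm (P ⊓ Q))
    (hcomap : ∀ P, adm' P → adm (P.comap φ)) {a b : ℕ} {Q : Subgroup B} (hQ : adm Q)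
    {R : Subgroup C} (hR : R ≤ Q.map φ) (ha : HasChain s adm a (Q ⊓ φ.ker))
    (hb : HasChain s adm' b R) : HasChain s adm (a + b) Q := by
  induction b generalizing Q R with
  | zero => exact ha.mono inf_le_left
  | succ b ih =>
    obtain ⟨S, hS, hadm, hl, hc⟩ := hb
    -- The chain of the image is pulled back to `Q`. All its members contain `Q ⊓ φ.ker`, below
    -- which the other chain continues.
    refine ⟨Q ⊓ S.comap φ, inf_le_left, hinf _ _ hQ (hcomap S hadm), ?_,
      ih (hinf _ _ hQ (hcomap S hadm)) ?_ ?_ hc⟩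
    · rw [inf_comm, Subgroup.inf_relIndex_right, Subgroup.relIndex_comap]
      exact hl.mono_right hR
    · intro x hx
      obtain ⟨y, hy, rfl⟩ := hR (hS hx)
      exact ⟨y, ⟨hy, hx⟩, rfl⟩
    · refine ha.mono (le_inf (le_inf inf_le_left ?_) inf_le_right)
      intro x hx
      have : φ x = 1 := hx.2
      simp [this, S.one_mem]

/-- In a finite group, strict chains of subgroups are bounded. -/
theorem HasChain.lt_card [Finite B] {k : ℕ} {Q : Subgroup B} (h : HasChain True adm k Q) :
    k < Nat.card Q := by
  induction k generalizing Q with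
  | zero => exact Nat.card_pos
  | succ k ih =>
    obtain ⟨P, hP, -, hl, hc⟩ := h
    refine (Nat.succ_le_of_lt (ih hc)).trans_lt ?_
    apply Set.ncard_lt_ncard (s := (P : Set B)) (t := (Q : Set B)) _ (Set.toFinite _)
    refine ⟨hP, fun hQP => ?_⟩
    have h1 : P.relIndex Q = 1 := Subgroup.relIndex_eq_one.mpr hQP
    rcases hl with hl | hl
    · omega
    · exact hl.2 h1

/-- In a Noetherian topological group, chains of closed subgroups with infinite indices are
bounded by the Krull dimension. -/
theorem HasChain.le_topologicalKrullDim [TopologicalSpace B] [SeparatelyContinuousMul B]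
    [TopologicalSpace.NoetherianSpace B] {k : ℕ} {Q : Subgroup B} (hQ : IsClosed (Q : Set B))
    (h : HasChain False (fun P : Subgroup B => IsClosed (P : Set B)) k Q) :
    (k : WithBot ℕ∞) ≤ topologicalKrullDim B := by
  -- Identity components turn the chain into one of irreducible closed sets. Keeping 1 in the last
  -- member forces it into the next identity component; equality would put a finite-index subgroup
  -- of `Q` inside `P`.
  suffices ∀ Q : Subgroup B, IsClosed (Q : Set B) →
      HasChain False (fun P : Subgroup B => IsClosed (P : Set B)) k Q →
      ∃ c : LTSeries (TopologicalSpace.IrreducibleCloseds B), c.length = k ∧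
        (1 : B) ∈ c.last.carrier ∧ (c.last.carrier ⊆ Q) by
    obtain ⟨c, hc, -, -⟩ := this Q hQ h
    exact hc ▸ Order.LTSeries.length_le_krullDim c
  clear h hQ Q
  induction k with
  | zero =>
    intro Q hQ _
    obtain ⟨R, hRQ, hRc, hRi, -, -⟩ := exists_identityComponent_of_isClosed hQ
    exact ⟨RelSeries.singleton _ ⟨R, hRi, hRc⟩, rfl, R.one_mem, hRQ⟩
  | succ k ih =>
    rintro Q hQ ⟨P, hPQ, hP, hl, hc⟩
    obtain ⟨c, hc, h1, hsub⟩ := ih P hP hc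
    obtain ⟨R, hRQ, hRc, hRi, hRf, hR⟩ := exists_identityComponent_of_isClosed hQ
    have hlt : c.last < ⟨R, hRi, hRc⟩ := by
      refine ⟨hR _ c.last.isIrreducible h1 (hsub.trans hPQ), fun hle => ?_⟩
      have hRP : R ≤ P := fun x hx => hsub (hle hx)
      rcases hl with hl | hl
      · exact hRf (Subgroup.relIndex_eq_zero_of_le_left hRP hl)
      · exact hl.1
    exact ⟨c.snoc _ hlt, by simp [hc], by simp [R.one_mem], by simpa using hRQ⟩

end Chains

/-! ### The counting argument on sofic approximations -/

section SoficCounting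

/-- The vertices at which a map to permutations looks like a free action on a finite set `F`. -/
def IsGoodVertex {G V : Type*} [Group G] (φ : G → Equiv.Perm V) (F : Finset G) (v : V) : Prop :=
  ∀ g ∈ F, ∀ h ∈ F, φ (g * h) v = φ g (φ h v) ∧ (g ≠ h → φ g v ≠ φ h v)

open Classical in
theorem IsSofic.exists_few_bad_vertices {G : Type v} [Group G] (hG : IsSofic G) (F : Finset G)
    (D : ℕ) : ∃ (n : ℕ) (φ : G → Equiv.Perm (Fin n)),
      D * (Finset.univ.filter fun v => ¬ IsGoodVertex φ F v).card < n := by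
  -- A union bound over the pairs in `F ×ˢ F`, with two conditions per pair that each fail on at
  -- most `N⁻¹ * n` vertices; the summand 1 makes the final inequality strict.
  set N : ℝ := 2 * D * (F ×ˢ F).card + 1 with hN
  have hNpos : 0 < N := by positivity
  obtain ⟨n, hn, φ, h1, h2⟩ := hG F N⁻¹ (inv_pos.mpr hNpos)
  refine ⟨n, φ, ?_⟩
  have hsub : (Finset.univ.filter fun v => ¬ IsGoodVertex φ F v) ⊆
      (F ×ˢ F).biUnion fun p => (Finset.univ.filter fun v => φ (p.1 * p.2) v ≠ φ p.1 (φ p.2 v)) ∪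
        (Finset.univ.filter fun v => p.1 ≠ p.2 ∧ φ p.1 v = φ p.2 v) := by
    intro v hv
    have hv' := (Finset.mem_filter.mp hv).2
    unfold IsGoodVertex at hv'
    push Not at hv'
    obtain ⟨g, hg, h, hh, hgh⟩ := hv'
    simp only [Finset.mem_biUnion, Finset.mem_product, Finset.mem_union, Finset.mem_filter,
      Finset.mem_univ, true_and]
    refine ⟨(g, h), ⟨hg, hh⟩, ?_⟩
    by_cases hc : φ (g * h) v = φ g (φ h v)
    · exact Or.inr (hgh hc)
    · exact Or.inl hc
  have hcard : ((Finset.univ.filter fun v => ¬ IsGoodVertex φ F v).card : ℝ) ≤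
      (F ×ˢ F).card * (2 * (N⁻¹ * n)) := by
    have h3 := (Finset.card_le_card hsub).trans Finset.card_biUnion_le
    have h4 : ((Finset.univ.filter fun v => ¬ IsGoodVertex φ F v).card : ℝ) ≤
        ∑ p ∈ F ×ˢ F, (((Finset.univ.filter fun v => φ (p.1 * p.2) v ≠ φ p.1 (φ p.2 v)) ∪
        (Finset.univ.filter fun v => p.1 ≠ p.2 ∧ φ p.1 v = φ p.2 v)).card : ℝ) := by
      exact_mod_cast h3
    refine h4.trans ((Finset.sum_le_card_nsmul _ _ (2 * (N⁻¹ * n)) ?_).trans (by simp))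
    rintro ⟨g, h⟩ hp
    obtain ⟨hg, hh⟩ := Finset.mem_product.mp hp
    have h5 := h1 g hg h hh
    have h6 : ((Finset.univ.filter fun v => g ≠ h ∧ φ g v = φ h v).card : ℝ) ≤ N⁻¹ * n := by
      by_cases hgh : g = h
      · simp [hgh]; positivity
      · have h7 := h2 g hg h hh hgh
        have h8 := Finset.card_filter_add_card_filter_not (s := (Finset.univ : Finset (Fin n)))
          (fun v => φ g v ≠ φ h v)
        simp only [ne_eq, not_not, Finset.card_univ, Fintype.card_fin] at h8
        have h9 : ((Finset.univ.filter fun v => ¬ φ g v = φ h v).card : ℝ) +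
          (Finset.univ.filter fun v => φ g v = φ h v).card = n := by exact_mod_cast h8
        simp only [ne_eq, hgh, not_false_eq_true, true_and] at h7 ⊢
        linarith
    have h10 : ((((Finset.univ.filter fun v => φ (g * h) v ≠ φ g (φ h v)) ∪
        (Finset.univ.filter fun v => g ≠ h ∧ φ g v = φ h v)).card : ℕ) : ℝ) ≤
        (Finset.univ.filter fun v => φ (g * h) v ≠ φ g (φ h v)).card +
        (Finset.univ.filter fun v => g ≠ h ∧ φ g v = φ h v).card := by
      exact_mod_cast Finset.card_union_le _ _
    simp only
    linarith
  have hn' : (0 : ℝ) < n := by exact_mod_cast hn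
  have : (D : ℝ) * (Finset.univ.filter fun v => ¬ IsGoodVertex φ F v).card < n := by
    calc (D : ℝ) * (Finset.univ.filter fun v => ¬ IsGoodVertex φ F v).card
        ≤ D * ((F ×ˢ F).card * (2 * (N⁻¹ * n))) := by gcongr
      _ = (2 * D * (F ×ˢ F).card) * N⁻¹ * n := by ring
      _ < N * N⁻¹ * n := by
          have : (2 * D * (F ×ˢ F).card : ℝ) < N := by rw [hN]; linarith
          gcongr
      _ = n := by rw [mul_inv_cancel₀ hNpos.ne', one_mul]
  exact_mod_cast this

/-- The functions that are trivial outside a given set. -/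
def supportedOn {I : Type*} (A : Type*) [Group A] (S : Set I) : Subgroup (I → A) where
  carrier := {x | ∀ i, i ∉ S → x i = 1}
  one_mem' _ _ := rfl
  mul_mem' ha hb i hi := by simp [ha i hi, hb i hi]
  inv_mem' ha i hi := by simp [ha i hi]

variable {G : Type v} {A : Type u} [Group A] {M : Finset G}

/-- The analogue of a cellular automaton on a set with maps indexed by the memory set. -/
def graphHom {V : Type*} (f : (M → A) →* A) (ψ : V → M → V) : (V → A) →* (V → A) where
  toFun x u := f fun m => x (ψ u m)
  map_one' := funext fun _ => f.map_one
  map_mul' a b := funext fun u => f.map_mul (fun m => a (ψ u m)) (fun m => b (ψ u m))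

open Classical in
/-- Transport of configurations along a map that is injective on `L`. -/
noncomputable def pushforward {V : Type*} (A : Type*) [Group A] (L : Set G) (θ : G → V) :
    (G → A) →* (V → A) where
  toFun z u := if h : ∃ g ∈ L, θ g = u then z h.choose else 1
  map_one' := by ext u; simp
  map_mul' a b := by
    ext u
    by_cases h : ∃ g ∈ L, θ g = u <;> simp [h]

theorem pushforward_apply {V : Type*} {L : Set G} {θ : G → V} (hθ : L.InjOn θ) (z : G → A) {g : G}
    (hg : g ∈ L) : pushforward A L θ z (θ g) = z g := by
  have h : ∃ g' ∈ L, θ g' = θ g := ⟨g, hg, rfl⟩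
  simp only [pushforward, MonoidHom.coe_mk, OneHom.coe_mk, dif_pos h]
  exact congrArg z (hθ h.choose_spec.1 hg h.choose_spec.2)

theorem pushforward_apply_of_forall_ne {V : Type*} {L : Set G} {θ : G → V} (z : G → A) {u : V}
    (hu : ∀ g ∈ L, θ g ≠ u) : pushforward A L θ z u = 1 := by
  have h : ¬ ∃ g ∈ L, θ g = u := by simpa using hu
  simp only [pushforward, MonoidHom.coe_mk, OneHom.coe_mk, dif_neg h]

theorem pushforward_mem_supportedOn {V : Type*} {L S : Set G} {θ : G → V} (hθ : L.InjOn θ)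
    {z : G → A} (hz : z ∈ supportedOn A S) :
    pushforward A L θ z ∈ supportedOn A (θ '' S) := by
  intro u hu
  by_cases h : ∃ g ∈ L, θ g = u
  · obtain ⟨g, hg, rfl⟩ := h
    rw [pushforward_apply hθ z hg]
    exact hz g fun hgS => hu ⟨g, hgS, rfl⟩
  · exact pushforward_apply_of_forall_ne z (by simpa using h)

theorem supportedOn_le_of_mulSingle_mem {I : Type*} [DecidableEq I] (S : Finset I)
    {H : Subgroup (I → A)} (h : ∀ i ∈ S, ∀ a, Pi.mulSingle i a ∈ H) :
    supportedOn A (S : Set I) ≤ H := by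
  induction S using Finset.induction_on with
  | empty =>
    intro x hx
    have : x = 1 := funext fun i => hx i (by simp)
    exact this ▸ H.one_mem
  | insert i S _ ih =>
    intro x hx
    have h1 : x = Pi.mulSingle i (x i) * Function.update x i 1 := by
      ext j
      by_cases hj : j = i
      · subst hj; simp
      · simp [hj]
    rw [h1]
    refine H.mul_mem (h i (by simp) _) (ih (fun j hj => h j (by simp [hj])) ?_)
    intro j hj
    by_cases hji : j = i
    · subst hji; simp
    · simp only [ne_eq, hji, not_false_eq_true, Function.update_of_ne]
      exact hx j (by simpa [hji] using hj)

/-- Classes of admissible subgroups of a group and of its finite powers that are compatible with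
the maps needed in the counting argument. -/
structure IsAdmissibleClass (f : (M → A) →* A) (adm' : Subgroup A → Prop)
    (adm : ∀ n : ℕ, Subgroup (Fin n → A) → Prop) : Prop where
  bot : adm' ⊥
  adm_sInf : ∀ (n : ℕ) (T : Set (Subgroup (Fin n → A))), (∀ P ∈ T, adm n P) → adm n (sInf T)
  comap_graphHom : ∀ (n : ℕ) (ψ : Fin n → M → Fin n) (P : Subgroup (Fin n → A)), adm n P →
    adm n (P.comap (graphHom f ψ))
  comap_eval : ∀ (n : ℕ) (v : Fin n) (P : Subgroup A), adm' P →
    adm n (P.comap (Pi.evalMonoidHom (fun _ : Fin n => A) v))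
  map_eval : ∀ (n : ℕ) (v : Fin n) (P : Subgroup (Fin n → A)), adm n P →
    adm' (P.map (Pi.evalMonoidHom (fun _ : Fin n => A) v))

namespace IsAdmissibleClass

variable {f : (M → A) →* A} {adm' : Subgroup A → Prop}
  {adm : ∀ n : ℕ, Subgroup (Fin n → A) → Prop} (h : IsAdmissibleClass f adm' adm) {n : ℕ}

include h

theorem top : adm n ⊤ := by
  rw [← sInf_empty]; exact h.adm_sInf n ∅ (by simp)

theorem inf {P Q : Subgroup (Fin n → A)} (hP : adm n P) (hQ : adm n Q) : adm n (P ⊓ Q) := by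
  rw [← sInf_pair]
  exact h.adm_sInf n _ (by rintro R (rfl | rfl) <;> assumption)

theorem ker_eval (v : Fin n) : adm n (Pi.evalMonoidHom (fun _ : Fin n => A) v).ker :=
  h.comap_eval n v ⊥ h.bot

theorem adm_supportedOn (S : Set (Fin n)) : adm n (supportedOn A S) := by
  have : supportedOn A S =
      sInf ((fun v => (Pi.evalMonoidHom (fun _ : Fin n => A) v).ker) '' Sᶜ) := by
    ext x
    simp only [Subgroup.mem_sInf, Set.forall_mem_image, Set.mem_compl_iff]
    rfl
  rw [this]
  apply h.adm_sInf
  rintro _ ⟨v, -, rfl⟩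
  exact h.ker_eval v

theorem ker_graphHom (ψ : Fin n → M → Fin n) : adm n (graphHom f ψ).ker := by
  have h1 : adm n ⊥ := by
    have : (⊥ : Subgroup (Fin n → A)) = supportedOn A ∅ := by
      ext x
      simp [supportedOn, ← SetLike.mem_coe, funext_iff]
    rw [this]; exact h.adm_supportedOn _
  exact h.comap_graphHom n ψ ⊥ h1

theorem hasChain_supportedOn {s : Prop} {d : ℕ} (hd : HasChain s adm' d ⊤)
    (S : Finset (Fin n)) : HasChain s (adm n) (d * S.card) (supportedOn A (S : Set (Fin n))) := by
  classical
  induction S using Finset.induction_on with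
  | empty => trivial
  | insert v S hv ih =>
    rw [Finset.card_insert_of_notMem hv, mul_add, mul_one]
    refine HasChain.add (Pi.evalMonoidHom (fun _ : Fin n => A) v) (fun _ _ => h.inf)
      (h.comap_eval n v) (h.adm_supportedOn _) (R := ⊤) ?_ (ih.mono ?_) hd
    · intro a _
      refine ⟨Pi.mulSingle v a, ?_, by simp⟩
      intro u hu
      have : u ≠ v := by rintro rfl; simp at hu
      simp [this]
    · intro x hx
      refine ⟨fun u hu => hx u (by simp_all), ?_⟩
      exact hx v hv

/-- Evaluation at one vertex splits a chain into at most `d` links in `A` and a chain supported on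
the other vertices. Together with `hasChain_supportedOn` this makes maximal chain length
proportional to the number of vertices. -/
theorem le_of_hasChain_supportedOn {s : Prop} {d : ℕ} (hd : ∀ k, HasChain s adm' k ⊤ → k ≤ d)
    (S : Finset (Fin n)) {k : ℕ}
    (hk : HasChain s (adm n) k (supportedOn A (S : Set (Fin n)))) : k ≤ d * S.card := by
  classical
  induction S using Finset.induction_on generalizing k with
  | empty =>
    cases k with
    | zero => simp
    | succ k =>
      obtain ⟨P, hP, -, hl, -⟩ := hk
      have : supportedOn A ((∅ : Finset (Fin n)) : Set (Fin n)) ≤ P := by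
        intro x hx
        have : x = 1 := funext fun i => hx i (by simp)
        exact this ▸ P.one_mem
      rw [Subgroup.relIndex_eq_one.mpr this] at hl
      rcases hl with hl | hl
      · omega
      · exact absurd rfl hl.2
  | insert v S hv ih =>
    obtain ⟨a, b, hab, ha, hb⟩ := hk.exists_add (Pi.evalMonoidHom (fun _ : Fin n => A) v)
      (fun P hP => h.inf hP (h.ker_eval v)) (h.map_eval n v)
    have h1 : a ≤ d * S.card := by
      refine ih (ha.mono ?_)
      rintro x ⟨hx, hxv⟩ u hu
      by_cases huv : u = v
      · subst huv; exact hxv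
      · exact hx u (by simp_all)
    have h2 : b ≤ d := hd b (hb.mono le_top)
    rw [Finset.card_insert_of_notMem hv, mul_add, mul_one]
    omega

end IsAdmissibleClass

variable [Group G]

/-- The cellular automaton with local defining map `f`, as a homomorphism. -/
def caHom (f : (M → A) →* A) : (G → A) →* (G → A) where
  toFun c g := f fun m => c (g * m)
  map_one' := funext fun _ => f.map_one
  map_mul' a b := funext fun g => f.map_mul (fun m => a (g * m)) (fun m => b (g * m))

/-- Inside the window `L` the local rule looks the same in `G` and on `V`. Both sides are trivial
away from the points θ(g m⁻¹) with g ∈ S; there the rule reads θ(g m⁻¹ m'), which is why `L` must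
contain these products. -/
theorem graphHom_pushforward {V : Type*} (f : (M → A) →* A) (φ : G → Equiv.Perm V) {L S : Set G}
    {θ : G → V} (hθ : L.InjOn θ) (hφ : ∀ g ∈ L, ∀ m ∈ M, θ (g * m) = φ m⁻¹ (θ g))
    (hSM : ∀ g ∈ S, ∀ m ∈ M, g * m⁻¹ ∈ L)
    (hSMM : ∀ g ∈ S, ∀ m ∈ M, ∀ m' ∈ M, g * m⁻¹ * m' ∈ L) {z : G → A}
    (hz : z ∈ supportedOn A S) :
    graphHom f (fun u m => φ (m : G)⁻¹ u) (pushforward A L θ z) =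
      pushforward A L θ (caHom f z) := by
  ext u
  by_cases hu : ∃ g ∈ S, ∃ m ∈ M, θ (g * m⁻¹) = u
  · obtain ⟨g, hg, m, hm, rfl⟩ := hu
    rw [pushforward_apply hθ _ (hSM g hg m hm)]
    change f _ = f _
    congr 1
    ext m'
    change pushforward A L θ z (φ (m' : G)⁻¹ (θ (g * m⁻¹))) = _
    rw [← hφ _ (hSM g hg m hm) _ m'.2, pushforward_apply hθ _ (hSMM g hg m hm _ m'.2)]
  · push Not at hu
    have h1 : graphHom f (fun u m => φ (m : G)⁻¹ u) (pushforward A L θ z) u = 1 := by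
      have : (fun m : M => pushforward A L θ z (φ (m : G)⁻¹ u)) = 1 := by
        ext m
        by_cases h : ∃ g ∈ L, θ g = φ (m : G)⁻¹ u
        · obtain ⟨g, hg, hgu⟩ := h
          rw [← hgu, pushforward_apply hθ _ hg]
          refine hz g fun hgS => hu g hgS m m.2 ((φ (m : G)⁻¹).injective ?_)
          rw [← hφ _ (hSM g hgS m m.2) m m.2, ← hgu, inv_mul_cancel_right]
        · exact pushforward_apply_of_forall_ne z (by simpa using h)
      change f _ = 1
      rw [this, map_one]
    rw [h1]
    by_cases h : ∃ g ∈ L, θ g = u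
    · obtain ⟨g, hg, rfl⟩ := h
      rw [pushforward_apply hθ _ hg]
      have : (fun m : M => z (g * m)) = 1 := by
        ext m
        exact hz _ fun hgS => hu _ hgS m m.2 (by rw [mul_inv_cancel_right])
      change 1 = f _
      rw [this, map_one]
    · exact (pushforward_apply_of_forall_ne _ (by simpa using h)).symm

/-- The counting argument: over a sofic group, if every alphabet element supported at `1` has a
preimage supported in a fixed finite set, then the finitely supported part of the kernel is not
large. -/
theorem not_isLargeIndex_card_ker (hG : IsSofic G) (f : (M → A) →* A) (E : Finset G)
    [DecidableEq G]
    (hE : ∀ a : A, ∃ z ∈ supportedOn A (E : Set G), caHom f z = Pi.mulSingle 1 a)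
    (Ω : Finset G) {s : Prop} {adm' : Subgroup A → Prop}
    {adm : ∀ n : ℕ, Subgroup (Fin n → A) → Prop} (hadm : IsAdmissibleClass f adm' adm)
    {D : ℕ} (hD : ∀ k, HasChain s adm' k ⊤ → k ≤ D) :
    ¬ IsLargeIndex s
      (Nat.card ((caHom f).ker ⊓ supportedOn A (Ω : Set G) : Subgroup (G → A))) := by
  classical
  intro hlarge
  set K : Subgroup (G → A) := (caHom f).ker ⊓ supportedOn A (Ω : Set G)
  obtain ⟨d, hd, hdmax⟩ : ∃ d, HasChain s adm' d ⊤ ∧ ∀ k, HasChain s adm' k ⊤ → k ≤ d :=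
    ⟨Nat.findGreatest (fun k => HasChain s adm' k ⊤) D,
      Nat.findGreatest_spec (P := fun k => HasChain s adm' k ⊤) (Nat.zero_le D) trivial,
      fun k hk => Nat.le_findGreatest (hD k hk) hk⟩
  let S : Finset G := E ∪ Ω
  let L : Finset G := insert 1 (S ∪ (S ×ˢ M).image (fun p => p.1 * p.2⁻¹) ∪
    (S ×ˢ M ×ˢ M).image (fun p => p.1 * p.2.1⁻¹ * p.2.2))
  let F : Finset G := L.image (·⁻¹) ∪ M.image (·⁻¹)
  -- A translate of Ω meets the translates of Ω at no more than |Ω|² vertices, so a maximal disjoint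
  -- family has at least |Vg|/c members. The factor `c * d + 1` on the next line is what the final
  -- inequality needs.
  let c : ℕ := Ω.card * Ω.card + 1
  obtain ⟨n, φ, hbad⟩ := hG.exists_few_bad_vertices F (c * d + 1)
  let Vg : Finset (Fin n) := Finset.univ.filter fun v => IsGoodVertex φ F v
  -- The inverse turns right multiplication by `m` in `G` into the permutation `φ m⁻¹`.
  let θ : Fin n → G → Fin n := fun v g => φ g⁻¹ v
  have hLS : ∀ g ∈ (S : Set G), g ∈ (L : Set G) := fun g hg => by
    simp only [L, Finset.coe_insert, Finset.coe_union, Set.mem_insert_iff, Set.mem_union]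
    exact Or.inr (Or.inl (Or.inl hg))
  have hLSM : ∀ g ∈ (S : Set G), ∀ m ∈ M, g * m⁻¹ ∈ (L : Set G) := fun g hg m hm => by
    simp only [L, Finset.coe_insert, Finset.coe_union, Set.mem_insert_iff, Set.mem_union]
    refine Or.inr (Or.inl (Or.inr ?_))
    exact Finset.mem_coe.mpr (Finset.mem_image.mpr ⟨(g, m), Finset.mem_product.mpr ⟨hg, hm⟩, rfl⟩)
  have hLSMM : ∀ g ∈ (S : Set G), ∀ m ∈ M, ∀ m' ∈ M, g * m⁻¹ * m' ∈ (L : Set G) :=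
    fun g hg m hm m' hm' => by
    simp only [L, Finset.coe_insert, Finset.coe_union, Set.mem_insert_iff, Set.mem_union]
    refine Or.inr (Or.inr ?_)
    exact Finset.mem_coe.mpr (Finset.mem_image.mpr ⟨(g, m, m'), Finset.mem_product.mpr
      ⟨hg, Finset.mem_product.mpr ⟨hm, hm'⟩⟩, rfl⟩)
  have hFL : ∀ g ∈ L, g⁻¹ ∈ F := fun g hg =>
    Finset.mem_union_left _ (Finset.mem_image_of_mem _ hg)
  have hFM : ∀ g ∈ M, g⁻¹ ∈ F := fun g hg =>
    Finset.mem_union_right _ (Finset.mem_image_of_mem _ hg)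
  have hinj : ∀ v ∈ Vg, (L : Set G).InjOn (θ v) := by
    intro v hv g hg g' hg' hgg
    have hv' := (Finset.mem_filter.mp hv).2
    by_contra hne
    exact (hv' _ (hFL g hg) _ (hFL g' hg')).2 (fun h => hne (inv_injective h)) hgg
  have hφ : ∀ v ∈ Vg, ∀ g ∈ (L : Set G), ∀ m ∈ M, θ v (g * m) = φ m⁻¹ (θ v g) := by
    intro v hv g hg m hm
    have hv' := (Finset.mem_filter.mp hv).2
    simp only [θ, mul_inv_rev]
    exact (hv' _ (hFM m hm) _ (hFL g hg)).1
  have hθ1 : ∀ v ∈ Vg, θ v 1 = v := by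
    intro v hv
    have hv' := (Finset.mem_filter.mp hv).2
    have h1 : (1 : G)⁻¹ ∈ F := hFL 1 (Finset.mem_insert_self _ _)
    have := (hv' _ h1 _ h1).1
    simp only [inv_one, mul_one] at this
    simpa [θ] using ((φ 1).injective this).symm
  set Φ : (Fin n → A) →* (Fin n → A) := graphHom f (fun u m => φ (m : G)⁻¹ u)
  have hpush : ∀ v ∈ Vg, ∀ z ∈ supportedOn A (S : Set G),
      Φ (pushforward A L (θ v) z) = pushforward A L (θ v) (caHom f z) := fun v hv z hz =>
    graphHom_pushforward f φ (hinj v hv) (hφ v hv) hLSM hLSMM hz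
  have hmono : ∀ {T : Finset G}, T ⊆ S → supportedOn A (T : Set G) ≤ supportedOn A (S : Set G) :=
    fun hT z hz g hg => hz g fun h => hg (hT h)
  -- the image contains everything supported on good vertices
  have himage : supportedOn A (Vg : Set (Fin n)) ≤ (⊤ : Subgroup (Fin n → A)).map Φ := by
    refine supportedOn_le_of_mulSingle_mem Vg fun v hv a => ?_
    obtain ⟨z, hz, hza⟩ := hE a
    refine ⟨pushforward A L (θ v) z, trivial, ?_⟩
    rw [hpush v hv z (hmono Finset.subset_union_left hz), hza]
    ext u
    by_cases hu : ∃ g ∈ (L : Set G), θ v g = u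
    · obtain ⟨g, hg, rfl⟩ := hu
      rw [pushforward_apply (hinj v hv) _ hg]
      have h1L : (1 : G) ∈ (L : Set G) := Finset.mem_coe.mpr (Finset.mem_insert_self _ _)
      by_cases hg1 : g = 1
      · subst hg1
        rw [hθ1 v hv]; simp
      · have : θ v g ≠ v := fun h => hg1 (hinj v hv hg h1L (h.trans (hθ1 v hv).symm))
        simp [hg1, this]
    · rw [pushforward_apply_of_forall_ne _ (by simpa using hu)]
      have : u ≠ v := by
        rintro rfl
        exact hu ⟨1, Finset.mem_coe.mpr (Finset.mem_insert_self _ _), hθ1 u hv⟩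
      simp [this]
  -- a maximal family of disjoint translates
  let IsDisj : Finset (Fin n) → Prop := fun W =>
    W ⊆ Vg ∧ ∀ w ∈ W, ∀ w' ∈ W, w ≠ w' → Disjoint (θ w '' (Ω : Set G)) (θ w' '' (Ω : Set G))
  obtain ⟨W, hW, hWmax⟩ : ∃ W, IsDisj W ∧ ∀ W', IsDisj W' → W'.card ≤ W.card := by
    have hne : (Finset.univ.filter IsDisj).Nonempty :=
      ⟨∅, Finset.mem_filter.mpr ⟨Finset.mem_univ _, by simp, by simp⟩⟩
    obtain ⟨W, hW, hmax⟩ := Finset.exists_max_image _ Finset.card hne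
    exact ⟨W, (Finset.mem_filter.mp hW).2, fun W' hW' =>
      hmax W' (Finset.mem_filter.mpr ⟨Finset.mem_univ _, hW'⟩)⟩
  have hWcard : Vg.card ≤ W.card * c := by
    have hsub : Vg ⊆ W ∪ (W ×ˢ (Ω ×ˢ Ω)).image
        (fun p => (φ p.2.1⁻¹)⁻¹ (φ p.2.2⁻¹ p.1)) := by
      intro v hv
      by_contra hcon
      rw [Finset.mem_union, not_or] at hcon
      obtain ⟨hvW, hvI⟩ := hcon
      have hdisj : ∀ w ∈ W, Disjoint (θ v '' (Ω : Set G)) (θ w '' (Ω : Set G)) := by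
        intro w hw
        rw [Set.disjoint_left]
        rintro _ ⟨g, hg, rfl⟩ ⟨h, hh, hgh⟩
        refine hvI (Finset.mem_image.mpr ⟨(w, g, h), by simp_all, ?_⟩)
        simp only [θ] at hgh
        rw [hgh]; simp
      have := hWmax (insert v W) ⟨Finset.insert_subset hv hW.1, ?_⟩
      · rw [Finset.card_insert_of_notMem hvW] at this; omega
      · intro w hw w' hw' hne
        rcases Finset.mem_insert.mp hw with rfl | hwW
        · rcases Finset.mem_insert.mp hw' with rfl | hw'
          · exact absurd rfl hne
          · exact hdisj w' hw'
        · rcases Finset.mem_insert.mp hw' with rfl | hw'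
          · exact (hdisj w hwW).symm
          · exact hW.2 w hwW w' hw' hne
    refine (Finset.card_le_card hsub).trans ((Finset.card_union_le _ _).trans ?_)
    have := Finset.card_image_le (s := W ×ˢ (Ω ×ˢ Ω))
      (f := fun p => (φ p.2.1⁻¹)⁻¹ (φ p.2.2⁻¹ p.1))
    rw [Finset.card_product, Finset.card_product] at this
    simp only [c]
    linarith
  -- the kernel contains a long chain
  let U : Finset (Fin n) → Set (Fin n) := fun W' => ⋃ w ∈ W', θ w '' (Ω : Set G)
  have hkernel : ∀ W' ⊆ W, HasChain s (adm n) W'.card (Φ.ker ⊓ supportedOn A (U W')) := by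
    intro W'
    induction W' using Finset.induction_on with
    | empty => intro _; trivial
    | insert w W' hw ih =>
      intro hsub
      have hwW : w ∈ W := hsub (Finset.mem_insert_self _ _)
      have hW'W : W' ⊆ W := (Finset.subset_insert _ _).trans hsub
      have hwV : w ∈ Vg := hW.1 hwW
      have hUle : U W' ⊆ U (insert w W') := by
        simp only [U, Finset.set_biUnion_insert]; exact Set.subset_union_right
      have hUw : θ w '' (Ω : Set G) ⊆ U (insert w W') := by
        simp only [U, Finset.set_biUnion_insert]; exact Set.subset_union_left
      rw [Finset.card_insert_of_notMem hw]
      refine ⟨Φ.ker ⊓ supportedOn A (U W'),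
        inf_le_inf_left _ fun x hx i hi => hx i fun h => hi (hUle h),
        hadm.inf (hadm.ker_graphHom _) (hadm.adm_supportedOn _), ?_, ih hW'W⟩
      -- A copy of `K` carried to the translate of Ω at `w` meets the functions supported on the
      -- other translates trivially, so the relative index there is the cardinality of `K`.
      refine IsLargeIndex.mono_right (K := K.map (pushforward A L (θ w))) ?_ ?_
      · rintro _ ⟨z, ⟨hz, hzΩ⟩, rfl⟩
        refine ⟨?_, fun i hi => pushforward_mem_supportedOn (hinj w hwV) hzΩ i fun h => hi (hUw h)⟩
        change Φ _ = 1
        rw [hpush w hwV z (hmono Finset.subset_union_right hzΩ),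
          show caHom f z = 1 from hz, map_one]
      · rw [← Subgroup.relIndex_comap, ← Subgroup.inf_relIndex_right]
        have hbot : (Φ.ker ⊓ supportedOn A (U W')).comap (pushforward A L (θ w)) ⊓ K = ⊥ := by
          rw [eq_bot_iff]
          rintro z ⟨⟨-, hzU⟩, -, hzΩ⟩
          rw [Subgroup.mem_bot]
          ext g
          by_cases hg : g ∈ (Ω : Set G)
          · rw [← pushforward_apply (hinj w hwV) z (hLS g (Finset.subset_union_right hg))]
            refine hzU _ fun hmem => ?_
            simp only [U, Set.mem_iUnion] at hmem
            obtain ⟨w', hw', hmem⟩ := hmem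
            have hne : w ≠ w' := by rintro rfl; exact hw hw'
            exact Set.disjoint_left.mp (hW.2 w hwW w' (hW'W hw') hne) ⟨g, hg, rfl⟩ hmem
          · exact hzΩ g hg
        rw [hbot, Subgroup.relIndex_bot_left]
        exact hlarge
  -- The kernel of Φ contributes |W| links and its image d·|Vg|. The bound d·n then leaves |W| ≤
  -- d·b, where b = n − |Vg| counts the bad vertices.
  have hchain : HasChain s (adm n) (W.card + d * Vg.card) ⊤ :=
    HasChain.add Φ (fun _ _ => hadm.inf) (hadm.comap_graphHom n _) hadm.top himage
      ((hkernel W Finset.Subset.rfl).mono (le_inf le_top inf_le_left))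
      (hadm.hasChain_supportedOn hd Vg)
  have hle := hadm.le_of_hasChain_supportedOn hdmax Finset.univ
    (hchain.mono (fun x _ i hi => absurd (by simp) hi))
  have hcompl : Vg.card + (Finset.univ.filter fun v => ¬ IsGoodVertex φ F v).card = n := by
    have := Finset.card_filter_add_card_filter_not (s := (Finset.univ : Finset (Fin n)))
      (fun v => IsGoodVertex φ F v)
    simpa using this
  rw [Finset.card_univ, Fintype.card_fin] at hle
  set b := (Finset.univ.filter fun v => ¬ IsGoodVertex φ F v).card
  have h1 : W.card ≤ d * b := by
    have h3 : d * n = d * Vg.card + d * b := by rw [← mul_add, hcompl]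
    omega
  -- Hence n − b = |Vg| ≤ c|W| ≤ cdb, contrary to (cd + 1)b < n.
  have h2 : W.card * c ≤ d * b * c := Nat.mul_le_mul_right c h1
  have h3 : (c * d + 1) * b = d * b * c + b := by ring
  omega

end SoficCounting

/-! ### Dimension and points of finitely generated algebras -/

section FinitelyGeneratedAlgebras

/-- Lying over lifts the smallest prime of a chain and going up lifts the rest. -/
theorem ringKrullDim_le_of_isIntegral_of_injective {R S : Type*} [CommRing R] [CommRing S]
    [Algebra R S] [Algebra.IsIntegral R S] (h : Function.Injective (algebraMap R S)) :
    ringKrullDim R ≤ ringKrullDim S := by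
  refine iSup_le fun l => ?_
  obtain ⟨Q, -, hQ, hQc⟩ := Ideal.exists_ideal_over_prime_of_isIntegral l.head.asIdeal
    (⊥ : Ideal S) (by
      rw [← RingHom.ker_eq_comap_bot, (RingHom.injective_iff_ker_eq_bot _).mp h]; exact bot_le)
  have : Q.LiesOver l.head.asIdeal := ⟨hQc.symm⟩
  obtain ⟨L, hL, -⟩ := Ideal.exists_ltSeries_of_hasGoingUp l Q
  exact hL ▸ Order.LTSeries.length_le_krullDim L

theorem ringKrullDim_le_of_isIntegral {R S : Type*} [CommRing R] [CommRing S]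
    [Algebra R S] [Algebra.IsIntegral R S] : ringKrullDim S ≤ ringKrullDim R :=
  Order.krullDim_le_of_strictMono (PrimeSpectrum.comap (algebraMap R S))
    fun _ _ h => Ideal.IsIntegral.comap_lt_comap h

variable (K : Type u) [Field K]

theorem ringKrullDim_lt_top_of_finiteType (S : Type*) [CommRing S] [Algebra K S]
    [Algebra.FiniteType K S] : ∃ d : ℕ, ringKrullDim S ≤ d := by
  obtain ⟨n, f, hf⟩ := Algebra.FiniteType.iff_quotient_mvPolynomial''.mp
    (inferInstance : Algebra.FiniteType K S)
  refine ⟨n, (ringKrullDim_le_of_surjective f.toRingHom hf).trans ?_⟩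
  rw [MvPolynomial.ringKrullDim_of_isNoetherianRing, ringKrullDim_eq_zero_of_field]
  simp

theorem trdeg_eq_of_isIntegral_of_injective {S : Type u} [CommRing S] [IsDomain S] [Algebra K S]
    {n : ℕ} (g : MvPolynomial (Fin n) K →ₐ[K] S) (hg : Function.Injective g)
    (hi : g.IsIntegral) : Algebra.trdeg K S = n := by
  algebraize [g.toRingHom]
  have hsc : IsScalarTower K (MvPolynomial (Fin n) K) S :=
    IsScalarTower.of_algebraMap_eq fun r => (g.commutes r).symm
  have hfs : FaithfulSMul (MvPolynomial (Fin n) K) S :=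
    (faithfulSMul_iff_algebraMap_injective _ _).mpr hg
  have h := trdeg_add_eq K (MvPolynomial (Fin n) K) (A := S)
  rw [MvPolynomial.trdeg_of_isDomain, trdeg_eq_zero] at h
  simpa using h.symm

/-- Krull dimension is monotone along injections of finitely generated domains over a field. -/
theorem ringKrullDim_le_of_injective {R S : Type u} [CommRing R] [CommRing S] [IsDomain R]
    [IsDomain S] [Algebra K R] [Algebra K S] [Algebra.FiniteType K R] [Algebra.FiniteType K S]
    (f : R →ₐ[K] S) (hf : Function.Injective f) : ringKrullDim R ≤ ringKrullDim S := by
  obtain ⟨r, g, hg, hgi⟩ := exists_integral_inj_algHom_of_fg K R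
  obtain ⟨s, g', hg', hgi'⟩ := exists_integral_inj_algHom_of_fg K S
  -- Noether normalisation identifies `r` and `s` with transcendence degrees, which are monotone
  -- along injections.
  have hrs : r ≤ s := by
    have h := trdeg_le_of_injective f hf
    rw [trdeg_eq_of_isIntegral_of_injective K g hg hgi,
      trdeg_eq_of_isIntegral_of_injective K g' hg' hgi'] at h
    exact_mod_cast h
  have h1 : ringKrullDim R ≤ r := by
    algebraize [g.toRingHom]
    refine (ringKrullDim_le_of_isIntegral (R := MvPolynomial (Fin r) K)).trans ?_
    rw [MvPolynomial.ringKrullDim_of_isNoetherianRing, ringKrullDim_eq_zero_of_field]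
    simp
  have h2 : (s : WithBot ℕ∞) ≤ ringKrullDim S := by
    algebraize [g'.toRingHom]
    refine le_trans ?_ (ringKrullDim_le_of_isIntegral_of_injective
      (R := MvPolynomial (Fin s) K) hg')
    rw [MvPolynomial.ringKrullDim_of_isNoetherianRing, ringKrullDim_eq_zero_of_field]
    simp
  exact h1.trans (le_trans (by exact_mod_cast hrs) h2)

variable {K}

/-- Countably many nonzero polynomials over an uncountable field have a common nonzero. -/
theorem MvPolynomial.exists_forall_eval_ne_zero [Uncountable K] {n : ℕ}
    (g : ℕ → MvPolynomial (Fin n) K) (hg : ∀ i, g i ≠ 0) :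
    ∃ c : Fin n → K, ∀ i, MvPolynomial.eval c (g i) ≠ 0 := by
  induction n with
  | zero =>
    refine ⟨Fin.elim0, fun i h => hg i ?_⟩
    rw [MvPolynomial.eq_C_of_isEmpty (g i)] at h ⊢
    rw [MvPolynomial.eval_C] at h
    rw [h, map_zero]
  | succ n ih =>
    have hp : ∀ i, MvPolynomial.finSuccEquiv K n (g i) ≠ 0 := fun i => by
      simpa using hg i
    -- Once no leading coefficient vanishes at `c`, every polynomial specialises to a nonzero
    -- polynomial in one variable; their roots are countable in total.
    obtain ⟨c, hc⟩ := ih (fun i => (MvPolynomial.finSuccEquiv K n (g i)).leadingCoeff)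
      fun i => Polynomial.leadingCoeff_ne_zero.mpr (hp i)
    let p : ℕ → Polynomial K := fun i =>
      (MvPolynomial.finSuccEquiv K n (g i)).map (MvPolynomial.eval c)
    have hp' : ∀ i, p i ≠ 0 := by
      intro i h
      have := congrArg (fun q => q.coeff (MvPolynomial.finSuccEquiv K n (g i)).natDegree) h
      simp only [p, Polynomial.coeff_map, Polynomial.coeff_natDegree, Polynomial.coeff_zero] at this
      exact hc i this
    have hcount : (⋃ i, {x : K | (p i).IsRoot x}).Countable :=
      Set.countable_iUnion fun i => (Polynomial.finite_setOfPred_isRoot (hp' i)).countable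
    obtain ⟨x, hx⟩ : ∃ x, x ∉ ⋃ i, {x : K | (p i).IsRoot x} := by
      by_contra! hcon
      exact Set.not_countable_univ (Set.eq_univ_of_forall hcon ▸ hcount)
    refine ⟨Fin.cons x c, fun i h => hx (Set.mem_iUnion.mpr ⟨i, ?_⟩)⟩
    rw [MvPolynomial.eval_eq_eval_mv_eval'] at h
    exact h

/-- Over an uncountable algebraically closed field, an integral affine variety has a point outside
countably many given hypersurfaces. -/
theorem exists_algHom_forall_ne_zero [IsAlgClosed K] [Uncountable K] {S : Type*} [CommRing S]
    [Algebra K S] [Algebra.FiniteType K S] (q : Ideal S) [q.IsPrime] (h : ℕ → S)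
    (hq : ∀ i, h i ∉ q) :
    ∃ φ : S →ₐ[K] K, (∀ x ∈ q, φ x = 0) ∧ ∀ i, φ (h i) ≠ 0 := by
  obtain ⟨s, g, hg, hgi⟩ := exists_integral_inj_algHom_of_fg K (S ⧸ q)
  algebraize [g.toRingHom]
  have hsc : IsScalarTower K (MvPolynomial (Fin s) K) (S ⧸ q) :=
    IsScalarTower.of_algebraMap_eq fun r => (g.commutes r).symm
  -- By integrality every nonzero element of the domain `S ⧸ q` divides a nonzero polynomial of the
  -- Noether normalisation. This reduces the problem to affine space.
  have h1 : ∀ i, ∃ p : MvPolynomial (Fin s) K, p ≠ 0 ∧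
      algebraMap _ (S ⧸ q) p ∈ Ideal.span {Ideal.Quotient.mk q (h i)} := by
    intro i
    have hne : Ideal.Quotient.mk q (h i) ≠ 0 := fun h0 =>
      hq i (Ideal.Quotient.eq_zero_iff_mem.mp h0)
    have := Ideal.comap_ne_bot_of_integral_mem (R := MvPolynomial (Fin s) K) hne
      (Ideal.mem_span_singleton_self _) (Algebra.IsIntegral.isIntegral _)
    obtain ⟨p, hp, hp0⟩ := Submodule.exists_mem_ne_zero_of_ne_bot this
    exact ⟨p, hp0, hp⟩
  choose p hp0 hp using h1
  obtain ⟨c, hc⟩ := MvPolynomial.exists_forall_eval_ne_zero p hp0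
  have hmax : (RingHom.ker (MvPolynomial.eval c)).IsMaximal :=
    RingHom.ker_isMaximal_of_surjective _ fun x => ⟨MvPolynomial.C x, by simp⟩
  obtain ⟨Q, hQ, hQc⟩ := Ideal.exists_ideal_over_maximal_of_isIntegral (S := S ⧸ q)
    (RingHom.ker (MvPolynomial.eval c)) (by
      have h0 : Function.Injective (algebraMap (MvPolynomial (Fin s) K) (S ⧸ q)) := hg
      rw [(RingHom.injective_iff_ker_eq_bot _).mp h0]; exact bot_le)
  let _ := Ideal.Quotient.field Q
  have hfin : Module.Finite K ((S ⧸ q) ⧸ Q) := finite_of_finite_type_of_isJacobsonRing K _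
  have hbij : Function.Bijective (algebraMap K ((S ⧸ q) ⧸ Q)) :=
    IsAlgClosed.algebraMap_bijective_of_isIntegral
  let e : K ≃ₐ[K] ((S ⧸ q) ⧸ Q) := AlgEquiv.ofBijective (Algebra.ofId _ _) hbij
  refine ⟨(e.symm : ((S ⧸ q) ⧸ Q) →ₐ[K] K).comp
    ((Ideal.Quotient.mkₐ K Q).comp (Ideal.Quotient.mkₐ K q)), ?_, ?_⟩
  · intro x hx
    have : Ideal.Quotient.mk q x = 0 := Ideal.Quotient.eq_zero_iff_mem.mpr hx
    simp [this]
  · intro i hi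
    have h2 : Ideal.Quotient.mk Q (Ideal.Quotient.mk q (h i)) = 0 := by
      have := congrArg e hi
      simpa using this
    have h3 : Ideal.Quotient.mk q (h i) ∈ Q := Ideal.Quotient.eq_zero_iff_mem.mp h2
    have h4 : algebraMap _ (S ⧸ q) (p i) ∈ Q :=
      (Ideal.span_singleton_le_iff_mem Q).mpr h3 (hp i)
    have h5 : p i ∈ RingHom.ker (MvPolynomial.eval c) := hQc ▸ h4
    exact hc i h5

end FinitelyGeneratedAlgebras

/-! ### Schemes of finite type: products, constructible sets, dimension -/

section FiniteTypeSchemes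

open TopologicalSpace

variable {K : Type u} [Field K]

variable (K) in
/-- The property of `K`-schemes to be of finite type. -/
def isOfFiniteType : ObjectProperty (Over (Spec (.of K))) :=
  fun Y => LocallyOfFiniteType Y.hom ∧ QuasiCompact Y.hom

instance : (isOfFiniteType K).IsClosedUnderIsomorphisms where
  of_iso {Y Z} e h := by
    have h1 := h.1
    have h2 := h.2
    have he : e.inv.left ≫ Y.hom = Z.hom := Over.w e.inv
    have : IsIso e.inv.left := inferInstanceAs (IsIso ((Over.forget _).map e.inv))
    constructor
    · rw [← he]; infer_instance
    · rw [← he]; infer_instance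

instance : (isOfFiniteType K).IsClosedUnderLimitsOfShape (Discrete.{0} PEmpty) where
  limitsOfShape_le := by
    rintro Y ⟨p⟩
    have hY : IsTerminal Y :=
      (IsLimit.equivOfNatIsoOfIso p.diag.uniqueFromEmpty _ _
        (by exact Cone.ext (Iso.refl _) (by rintro ⟨⟨⟩⟩))).1 p.isLimit
    refine (isOfFiniteType K).prop_of_iso (Over.mkIdTerminal.uniqueUpToIso hY) ?_
    exact ⟨by dsimp; infer_instance, by dsimp; infer_instance⟩

open MonoidalCategory CartesianMonoidalCategory in
instance : (isOfFiniteType K).IsClosedUnderBinaryProducts := by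
  refine .mk' ?_
  rintro _ ⟨F, hF⟩
  have h1 := hF ⟨WalkingPair.left⟩
  have h2 := hF ⟨WalkingPair.right⟩
  let e : F.obj ⟨WalkingPair.left⟩ ⊗ F.obj ⟨WalkingPair.right⟩ ≅ limit F :=
    (tensorProductIsBinaryProduct _ _).conePointUniqueUpToIso
      (limit.isLimit (pair _ _)) ≪≫ HasLimit.isoOfNatIso (diagramIsoPair F).symm
  refine (isOfFiniteType K).prop_of_iso e ?_
  have := h1.1
  have := h1.2
  have := h2.1
  have := h2.2
  exact ⟨by dsimp; infer_instance, by dsimp; infer_instance⟩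

instance : (isOfFiniteType K).IsClosedUnderFiniteProducts := .mk'

theorem isOfFiniteType_power {X : Over (Spec (.of K))} [LocallyOfFiniteType X.hom]
    [QuasiCompact X.hom] (ι : Type v) [Finite ι] : isOfFiniteType K (power X ι) :=
  (isOfFiniteType K).prop_product fun _ => ⟨inferInstance, inferInstance⟩

instance {X : Over (Spec (.of K))} [LocallyOfFiniteType X.hom] [QuasiCompact X.hom] (ι : Type v)
    [Finite ι] : LocallyOfFiniteType (power X ι).hom := (isOfFiniteType_power ι).1

instance {X : Over (Spec (.of K))} [LocallyOfFiniteType X.hom] [QuasiCompact X.hom] (ι : Type v)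
    [Finite ι] : QuasiCompact (power X ι).hom := (isOfFiniteType_power ι).2

theorem isNoetherian_of_finiteType (Y : Over (Spec (.of K))) [LocallyOfFiniteType Y.hom]
    [QuasiCompact Y.hom] : IsNoetherian Y.left := by
  have h1 : IsLocallyNoetherian (Spec (.of K)) := by
    have : IsNoetherianRing (CommRingCat.of K) := inferInstanceAs (IsNoetherianRing K)
    infer_instance
  have := LocallyOfFiniteType.isLocallyNoetherian Y.hom
  have : CompactSpace Y.left := QuasiCompact.compactSpace_of_compactSpace Y.hom
  exact {}

theorem locallyOfFiniteType_left {Y Z : Over (Spec (.of K))} [LocallyOfFiniteType Y.hom]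
    (f : Y ⟶ Z) : LocallyOfFiniteType f.left := by
  have : LocallyOfFiniteType (f.left ≫ Z.hom) := by rw [Over.w]; infer_instance
  exact locallyOfFiniteType_of_comp f.left Z.hom

/-- Every point of a constructible set has a neighbourhood whose intersection with the closure of
the point is contained in the set. -/
theorem Topology.IsConstructible.exists_isOpen_inter_closure_subset {T : Type*} [TopologicalSpace T]
    {s : Set T} (hs : IsConstructible s) {x : T} (hx : x ∈ s) :
    ∃ U, IsOpen U ∧ x ∈ U ∧ U ∩ closure {x} ⊆ s := by
  -- Treating the set and its complement symmetrically lets the induction pass through complements.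
  suffices ∃ U, IsOpen U ∧ x ∈ U ∧ (x ∈ s → U ∩ closure {x} ⊆ s) ∧
      (x ∉ s → U ∩ closure {x} ⊆ sᶜ) by
    obtain ⟨U, h1, h2, h3, -⟩ := this
    exact ⟨U, h1, h2, h3 hx⟩
  clear hx
  induction hs using IsConstructible.empty_union_induction with
  | open_retrocompact U hU _ =>
    by_cases h : x ∈ U
    · exact ⟨U, hU, h, fun _ => Set.inter_subset_left, fun h' => absurd h h'⟩
    · refine ⟨Set.univ, isOpen_univ, trivial, fun h' => absurd h' h, fun _ => ?_⟩
      exact Set.inter_subset_right.trans (closure_minimal (by simpa using h) hU.isClosed_compl)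
  | union s hs t ht ihs iht =>
    obtain ⟨U, hU, hxU, h1, h2⟩ := ihs
    obtain ⟨V, hV, hxV, h3, h4⟩ := iht
    refine ⟨U ∩ V, hU.inter hV, ⟨hxU, hxV⟩, ?_, ?_⟩
    · rintro (h | h) y ⟨⟨hyU, hyV⟩, hy⟩
      · exact Or.inl (h1 h ⟨hyU, hy⟩)
      · exact Or.inr (h3 h ⟨hyV, hy⟩)
    · intro h y ⟨⟨hyU, hyV⟩, hy⟩ hy'
      rcases hy' with hy' | hy'
      · exact h2 (fun h' => h (Or.inl h')) ⟨hyU, hy⟩ hy'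
      · exact h4 (fun h' => h (Or.inr h')) ⟨hyV, hy⟩ hy'
  | compl s hs ih =>
    obtain ⟨U, hU, hxU, h1, h2⟩ := ih
    exact ⟨U, hU, hxU, h2, fun h => by rw [compl_compl]; exact h1 (not_not.mp h)⟩

/-- Chains of irreducible closed subsets whose smallest member meets the image of an open immersion
from an affine scheme give chains of primes. -/
theorem exists_ringKrullDim_quotient_ge {Z : Scheme.{u}} {R : CommRingCat.{u}} (j : Spec R ⟶ Z)
    [IsOpenImmersion j] (c : LTSeries (IrreducibleCloseds Z))
    (hc : (c.head.carrier ∩ Set.range j).Nonempty) :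
    ∃ p : PrimeSpectrum R, closure {j p} = c.last.carrier ∧
      (c.length : WithBot ℕ∞) ≤ ringKrullDim (R ⧸ p.asIdeal) := by
  have hj := j.isOpenEmbedding
  have hgen : ∀ i, ∃ p : PrimeSpectrum R, closure {j p} = (c i).carrier := by
    intro i
    obtain ⟨x, hx⟩ := QuasiSober.sober (c i).isIrreducible (c i).isClosed
    have hx' : closure {x} = (c i).carrier := hx
    obtain ⟨y, hy, hyj⟩ := hc
    have hyi : y ∈ (c i).carrier := c.head_le i hy
    have hxj : x ∈ Set.range j := by
      have : x ⤳ y := by rw [specializes_iff_mem_closure, hx']; exact hyi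
      exact this.mem_open hj.isOpen_range hyj
    obtain ⟨p, hp⟩ := hxj
    exact ⟨p, by rw [hp, hx']⟩
  choose p hp using hgen
  -- Larger closed sets have smaller generic primes. All primes of the chain thus contain the one of
  -- the last member, and the reversed chain lives in the quotient by it.
  have hanti : ∀ i k, i < k → p k < p i := by
    intro i k hik
    have hlt : c i < c k := c.strictMono hik
    have h1 : p k ⤳ p i := by
      have h2 : j (p k) ⤳ j (p i) := by
        rw [specializes_iff_mem_closure, hp k]
        have h3 : j (p i) ∈ (c i).carrier := by rw [← hp i]; exact subset_closure rfl
        exact hlt.le h3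
      exact hj.isInducing.specializes_iff.mp h2
    refine lt_of_le_of_ne ((PrimeSpectrum.le_iff_specializes _ _).mpr h1) fun h => ?_
    have : (c i).carrier = (c k).carrier := by rw [← hp i, ← hp k, h]
    exact hlt.ne (IrreducibleCloseds.ext this)
  refine ⟨p (Fin.last _), hp _, ?_⟩
  have hle : ∀ i, p (Fin.last _) ≤ p i := by
    intro i
    rcases (Fin.le_last i).eq_or_lt with h | h
    · rw [h]
    · exact (hanti i _ h).le
  let e := Ideal.primeSpectrumQuotientOrderIsoZeroLocus (p (Fin.last _)).asIdeal
  let l : LTSeries (PrimeSpectrum (R ⧸ (p (Fin.last _)).asIdeal)) :=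
    { length := c.length
      toFun := fun i => e.symm ⟨p i.rev, hle i.rev⟩
      step := fun i => by
        apply e.symm.strictMono
        exact hanti _ _ (Fin.rev_lt_rev.mpr (Fin.castSucc_lt_succ)) }
  exact Order.LTSeries.length_le_krullDim l

/-- The `K`-algebra structure on the coordinate ring of an affine scheme mapping to a
`K`-scheme. -/
noncomputable abbrev coordinateAlgebra {R : CommRingCat.{u}} (s : Spec R ⟶ Spec (.of K)) :
    Algebra K R :=
  (Spec.preimage s).hom.toAlgebra

theorem finiteType_coordinateAlgebra {R : CommRingCat.{u}} (s : Spec R ⟶ Spec (.of K))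
    [h : LocallyOfFiniteType s] : @Algebra.FiniteType K R _ _ (coordinateAlgebra s) := by
  rw [← Spec.map_preimage s, HasRingHomProperty.Spec_iff (P := @LocallyOfFiniteType)] at h
  exact h

/-- A chart meeting the smallest member of a chain sees the whole chain; finitely many charts give a
common bound. -/
theorem exists_topologicalKrullDim_le (Y : Over (Spec (.of K))) [LocallyOfFiniteType Y.hom]
    [QuasiCompact Y.hom] : ∃ d : ℕ, topologicalKrullDim Y.left ≤ d := by
  have : CompactSpace Y.left := QuasiCompact.compactSpace_of_compactSpace Y.hom
  let 𝒰 := Y.left.affineCover.finiteSubcover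
  have hd : ∀ i : 𝒰.I₀, ∃ d : ℕ, ringKrullDim (Γ(𝒰.X i, ⊤)) ≤ d := by
    intro i
    have : IsAffine (𝒰.X i) := inferInstance
    let s : Spec Γ(𝒰.X i, ⊤) ⟶ Spec (.of K) := (𝒰.X i).isoSpec.inv ≫ 𝒰.f i ≫ Y.hom
    have := finiteType_coordinateAlgebra s
    let _ := coordinateAlgebra s
    exact ringKrullDim_lt_top_of_finiteType K _
  choose d hd using hd
  have hfin : Finite 𝒰.I₀ := inferInstance
  obtain ⟨D, hD⟩ := Set.Finite.bddAbove (Set.finite_range d)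
  refine ⟨D, iSup_le fun c => ?_⟩
  obtain ⟨y, hy⟩ := c.head.isIrreducible.nonempty
  obtain ⟨i, x, hx⟩ := 𝒰.exists_eq y
  let j : Spec Γ(𝒰.X i, ⊤) ⟶ Y.left := (𝒰.X i).isoSpec.inv ≫ 𝒰.f i
  obtain ⟨p, -, hp⟩ := exists_ringKrullDim_quotient_ge j c
    ⟨y, hy, (𝒰.X i).isoSpec.hom x, by simp [j, ← hx, ← Scheme.Hom.comp_apply]⟩
  refine hp.trans ((ringKrullDim_quotient_le _).trans ((hd i).trans ?_))
  exact_mod_cast hD ⟨i, rfl⟩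

/-- If the generic point of the largest member of a chain of irreducible closed subsets of `Z` lies
in the image of `f : Y ⟶ Z`, then the length of the chain is at most the dimension of `Y`. -/
theorem length_le_topologicalKrullDim {Y Z : Over (Spec (.of K))} [LocallyOfFiniteType Y.hom]
    [LocallyOfFiniteType Z.hom] (f : Y ⟶ Z) (c : LTSeries (IrreducibleCloseds Z.left)) {y : Y.left}
    (hy : closure {f.left y} = c.last.carrier) :
    (c.length : WithBot ℕ∞) ≤ topologicalKrullDim Y.left := by
  obtain ⟨z, hz⟩ := c.head.isIrreducible.nonempty
  obtain ⟨R, j, hj, r, hr⟩ := Scheme.exists_Spec_apply_eq z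
  obtain ⟨p, hp, hle⟩ := exists_ringKrullDim_quotient_ge j c ⟨z, hz, r, hr⟩
  have hpy : f.left y = j p := by
    have h : Inseparable (f.left y) (j p) := by
      rw [inseparable_iff_closure_eq, hy, hp]
    exact h.eq
  -- an affine open neighbourhood of `y` inside the preimage
  have hyU : y ∈ f.left ⁻¹ᵁ j.opensRange := ⟨p, hpy.symm⟩
  obtain ⟨V, hV, hyV, hVle⟩ := exists_isAffineOpen_mem_and_subset hyU
  let i : Spec Γ(Y.left, V) ⟶ Y.left := hV.fromSpec
  have hiV : Set.range i = V := hV.range_fromSpec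
  obtain ⟨q, hq⟩ : ∃ q, i q = y := by
    have : y ∈ Set.range i := by rw [hiV]; exact hyV
    exact this
  have hfac : Set.range (i ≫ f.left) ⊆ Set.range j := by
    rintro _ ⟨t, rfl⟩
    have : i t ∈ V := by rw [← SetLike.mem_coe, ← hiV]; exact ⟨t, rfl⟩
    exact hVle this
  let g : Spec Γ(Y.left, V) ⟶ Spec R := IsOpenImmersion.lift j (i ≫ f.left) hfac
  have hg : g ≫ j = i ≫ f.left := IsOpenImmersion.lift_fac _ _ _
  obtain ⟨φ, hφ⟩ := Spec.map_surjective g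
  have hqp : g q = p := by
    apply j.isOpenEmbedding.injective
    rw [← hpy, ← Scheme.Hom.comp_apply, hg, Scheme.Hom.comp_apply, hq]
  let sR : Spec R ⟶ Spec (.of K) := j ≫ Z.hom
  let sS : Spec Γ(Y.left, V) ⟶ Spec (.of K) := i ≫ Y.hom
  have hgs : g ≫ sR = sS := by
    simp only [sR, sS]
    rw [← Category.assoc, hg, Category.assoc, Over.w]
  have hftR := finiteType_coordinateAlgebra sR
  have hftS := finiteType_coordinateAlgebra sS
  let _ := coordinateAlgebra sR
  let _ := coordinateAlgebra sS
  let φ' : R →ₐ[K] Γ(Y.left, V) :=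
    { φ.hom with
      commutes' := fun r => by
        have h1 : Spec.preimage sR ≫ φ = Spec.preimage sS := by
          apply Spec.map_injective
          rw [Spec.map_comp, Spec.map_preimage, Spec.map_preimage, hφ, hgs]
        have h2 := congrArg (fun t => t.hom r) h1
        exact h2 }
  have hcomap : q.asIdeal.comap φ'.toRingHom = p.asIdeal := by
    rw [← hqp, ← hφ]; rfl
  -- Since `q` contracts to `p`, this map of finitely generated domains is injective, and dimension
  -- is monotone along it.
  let ψ : (R ⧸ p.asIdeal) →ₐ[K] (Γ(Y.left, V) ⧸ q.asIdeal) :=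
    Ideal.quotientMapₐ q.asIdeal φ' hcomap.ge
  have hψ : Function.Injective ψ := Ideal.quotientMap_injective' (H := hcomap.ge) hcomap.le
  have : IsDomain (R ⧸ p.asIdeal) := Ideal.Quotient.isDomain _
  have : IsDomain (Γ(Y.left, V) ⧸ q.asIdeal) :=
    Ideal.Quotient.isDomain (hI := q.isPrime) _
  refine hle.trans ((ringKrullDim_le_of_injective K ψ hψ).trans
    ((ringKrullDim_quotient_le _).trans ?_))
  rw [← PrimeSpectrum.topologicalKrullDim_eq_ringKrullDim]
  exact i.isOpenEmbedding.isInducing.topologicalKrullDim_le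

end FiniteTypeSchemes

/-! ### From schemes to their `K`-points -/

section PointsTopology

open TopologicalSpace Topology

variable {K : Type u} [Field K]

/-- The point of the underlying space of `Y` given by a `K`-point. -/
noncomputable def pointOf {Y : Over (Spec (.of K))} (p : Pts Y) : Y.left :=
  p.left (IsLocalRing.closedPoint K)

/-- The Zariski topology on the set of `K`-points of a `K`-scheme. -/
noncomputable abbrev ptsTopology (Y : Over (Spec (.of K))) : TopologicalSpace (Pts Y) :=
  TopologicalSpace.induced pointOf inferInstance

attribute [local instance] ptsTopology

variable {Y Z : Over (Spec (.of K))}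

theorem isInducing_pointOf : IsInducing (pointOf (Y := Y)) := ⟨rfl⟩

theorem pointOf_comp (p : Pts Y) (f : Y ⟶ Z) : pointOf (p ≫ f) = f.left (pointOf p) := by
  exact Scheme.Hom.comp_apply p.left f.left _

theorem continuous_comp_right (f : Y ⟶ Z) : Continuous fun p : Pts Y => p ≫ f := by
  rw [isInducing_pointOf.continuous_iff]
  have : pointOf ∘ (fun p : Pts Y => p ≫ f) = f.left ∘ pointOf := by
    ext p; exact pointOf_comp p f
  rw [this]
  exact f.left.continuous.comp isInducing_pointOf.continuous

theorem isConstructible_image_left [LocallyOfFiniteType Y.hom]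
    [QuasiCompact Y.hom] [LocallyOfFiniteType Z.hom] [QuasiCompact Z.hom] (f : Y ⟶ Z)
    {W : Set Y.left} (hW : IsClosed W) : IsConstructible (f.left '' W) := by
  have := isNoetherian_of_finiteType Y
  have := isNoetherian_of_finiteType Z
  have := locallyOfFiniteType_left f
  have hc : IsConstructible W := by
    rw [← isConstructible_compl]
    exact IsRetrocompact.isConstructible hW.isOpen_compl fun _ _ _ => NoetherianSpace.isCompact _
  exact f.left.isConstructible_image hc

theorem noetherianSpace_pts [LocallyOfFiniteType Y.hom] [QuasiCompact Y.hom] :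
    NoetherianSpace (Pts Y) := by
  have := isNoetherian_of_finiteType Y
  exact isInducing_pointOf.noetherianSpace

variable [IsAlgClosed K] [LocallyOfFiniteType Y.hom]

theorem isClosed_singleton_pointOf (p : Pts Y) : IsClosed {pointOf p} :=
  (pointEquivClosedPoint Y.hom ⟨p.left, by simp⟩).2

theorem exists_pointOf_eq {y : Y.left} (hy : IsClosed {y}) : ∃ p : Pts Y, pointOf p = y :=
  ⟨Over.homMk (pointOfClosedPoint Y.hom y hy) (by simp),
    pointOfClosedPoint_apply Y.hom y hy _⟩

theorem pointOf_injective : Function.Injective (pointOf (Y := Y)) := by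
  intro p q h
  ext1
  exact ext_of_apply_closedPoint_eq Y.hom (by simp) (by simp) h

theorem t1Space_pts : T1Space (Pts Y) := by
  refine ⟨fun p => ?_⟩
  have : {p} = pointOf ⁻¹' {pointOf p} := by
    ext q; simp [pointOf_injective.eq_iff]
  rw [this]
  exact (isClosed_singleton_pointOf p).preimage isInducing_pointOf.continuous

/-- A nonempty locally closed subset of `Y` contains a `K`-point. -/
theorem exists_pointOf_mem {S : Set Y.left} (hS : IsLocallyClosed S) (hne : S.Nonempty) :
    ∃ p : Pts Y, pointOf p ∈ S := by
  have : JacobsonSpace Y.left := LocallyOfFiniteType.jacobsonSpace Y.hom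
  obtain ⟨y, hy, hyc⟩ := nonempty_inter_closedPoints hne hS
  obtain ⟨p, rfl⟩ := exists_pointOf_eq hyc
  exact ⟨p, hy⟩

theorem IsClosed.closure_image_preimage_pointOf {W : Set Y.left} (hW : IsClosed W) :
    closure (pointOf '' (pointOf (Y := Y) ⁻¹' W)) = W := by
  refine (closure_minimal (Set.image_preimage_subset _ _) hW).antisymm fun y hy => ?_
  rw [mem_closure_iff]
  intro U hU hyU
  obtain ⟨p, hpU, hpW⟩ := exists_pointOf_mem (hU.isLocallyClosed.inter hW.isLocallyClosed)
    ⟨y, hyU, hy⟩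
  exact ⟨_, hpU, p, hpW, rfl⟩

/-- `K`-points are the closed points, which are dense in every closed subset. Restriction to them
therefore keeps irreducible closed sets irreducible and distinct. -/
theorem topologicalKrullDim_pts : topologicalKrullDim (Pts Y) = topologicalKrullDim Y.left := by
  refine isInducing_pointOf.topologicalKrullDim_le.antisymm ?_
  have key : ∀ W : IrreducibleCloseds Y.left, IsIrreducible (pointOf (Y := Y) ⁻¹' W) := by
    intro W
    constructor
    · exact exists_pointOf_mem W.isClosed.isLocallyClosed W.isIrreducible.nonempty
    · rintro _ _ ⟨U, hU, rfl⟩ ⟨V, hV, rfl⟩ ⟨p, hpW, hpU⟩ ⟨q, hqW, hqV⟩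
      have := W.isIrreducible.2 U V hU hV ⟨_, hpW, hpU⟩ ⟨_, hqW, hqV⟩
      exact exists_pointOf_mem (W.isClosed.isLocallyClosed.inter (hU.inter hV).isLocallyClosed) this
  refine Order.krullDim_le_of_strictMono (fun W : IrreducibleCloseds Y.left =>
    (⟨pointOf ⁻¹' W, key W, W.isClosed.preimage isInducing_pointOf.continuous⟩ :
      IrreducibleCloseds (Pts Y))) ?_
  refine Monotone.strictMono_of_injective (fun W W' h p hp => h hp) fun W W' h => ?_
  have h' : pointOf (Y := Y) ⁻¹' W = pointOf ⁻¹' W' :=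
    congrArg (fun T : IrreducibleCloseds (Pts Y) => (T : Set (Pts Y))) h
  apply IrreducibleCloseds.ext
  rw [← W.isClosed.closure_image_preimage_pointOf, h', W'.isClosed.closure_image_preimage_pointOf]

/-- Over an uncountable algebraically closed field, an irreducible closed set of `K`-points which
is covered by countably many closed sets is contained in one of them. -/
theorem IsIrreducible.exists_subset_of_subset_iUnion_pts [Uncountable K] {T : Set (Pts Y)}
    (hTi : IsIrreducible T) (hT : IsClosed T) {F : ℕ → Set (Pts Y)} (hF : ∀ n, IsClosed (F n))
    (hTF : T ⊆ ⋃ n, F n) : ∃ n, T ⊆ F n := by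
  by_contra! hcon
  have hpre : ∀ S : Set (Pts Y), IsClosed S → pointOf ⁻¹' closure (pointOf '' S) = S := by
    intro S hS
    rw [← isInducing_pointOf.closure_eq_preimage_closure_image, hS.closure_eq]
  obtain ⟨w, hw⟩ := QuasiSober.sober
    (hTi.image pointOf isInducing_pointOf.continuous.continuousOn).closure isClosed_closure
  have hw' : closure {w} = closure (pointOf '' T) := hw
  have hwF : ∀ n, w ∉ closure (pointOf '' F n) := by
    intro n hn
    refine hcon n ?_
    rw [← hpre T hT, ← hpre (F n) (hF n), ← hw']
    exact Set.preimage_mono (closure_minimal (by simpa using hn) isClosed_closure)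
  obtain ⟨R, j, hj, q, hq⟩ := Scheme.exists_Spec_apply_eq w
  have hideal : ∀ n, ∃ I : Set R, j ⁻¹' closure (pointOf '' F n) = PrimeSpectrum.zeroLocus I :=
    fun n => (PrimeSpectrum.isClosed_iff_zeroLocus _).mp (isClosed_closure.preimage j.continuous)
  choose I hIF using hideal
  -- In a chart around the generic point `w` of `T`, each `F n` lies in the zero set of a function
  -- `h n` that does not vanish at `w`. A `K`-point of `T` avoiding all these zero sets lies in no
  -- `F n`.
  have hh : ∀ n, ∃ h ∈ I n, h ∉ q.asIdeal := by
    intro n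
    by_contra! hn
    have : q ∈ PrimeSpectrum.zeroLocus (I n) := hn
    rw [← hIF n] at this
    exact hwF n (by rw [← hq]; exact this)
  choose h hhI hhq using hh
  let s : Spec R ⟶ Spec (.of K) := j ≫ Y.hom
  have := finiteType_coordinateAlgebra s
  let _ := coordinateAlgebra s
  have := q.isPrime
  obtain ⟨φ, hφq, hφh⟩ := exists_algHom_forall_ne_zero (K := K) q.asIdeal h hhq
  let φ' : R ⟶ .of K := CommRingCat.ofHom φ.toRingHom
  have hs : Spec.map φ' ≫ s = 𝟙 _ := by
    rw [← Spec.map_preimage s, ← Spec.map_comp, ← Spec.map_id]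
    congr 1
    ext r
    exact φ.commutes r
  let p : Pts Y := Over.homMk (Spec.map φ' ≫ j) (by simpa [s] using hs)
  let t : PrimeSpectrum R := Spec.map φ' (IsLocalRing.closedPoint K)
  have ht : ∀ r, r ∈ t.asIdeal ↔ φ r = 0 := by
    intro r
    have : r ∈ t.asIdeal ↔ φ r ∈ (IsLocalRing.closedPoint K).asIdeal := Iff.rfl
    rw [this, IsLocalRing.closedPoint]
    simp
  have hp : pointOf p = j t := by
    exact Scheme.Hom.comp_apply (Spec.map φ') j _
  have hpT : p ∈ T := by
    rw [← hpre T hT, Set.mem_preimage, ← hw', ← hq, hp, ← specializes_iff_mem_closure]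
    refine Specializes.map ?_ j.continuous
    exact (PrimeSpectrum.le_iff_specializes q t).mp fun r hr => (ht r).mpr (hφq r hr)
  obtain ⟨n, hn⟩ := Set.mem_iUnion.mp (hTF hpT)
  have hmem : t ∈ j ⁻¹' closure (pointOf '' F n) :=
    subset_closure (s := pointOf '' F n) ⟨p, hn, hp⟩
  rw [hIF n] at hmem
  exact hφh n ((ht _).mp (hmem (hhI n)))

variable [QuasiCompact Y.hom]

theorem exists_topologicalKrullDim_pts_le : ∃ d : ℕ, topologicalKrullDim (Pts Y) ≤ d := by
  rw [topologicalKrullDim_pts]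
  exact exists_topologicalKrullDim_le Y

/-- Chevalley's theorem at the image of the generic point gives the open set. It descends to
`K`-points because a fibre over a `K`-point is closed and so contains a `K`-point of `W` if it meets
`W`. -/
theorem isChevalleyMap_comp_right [LocallyOfFiniteType Z.hom] [QuasiCompact Z.hom] (f : Y ⟶ Z) :
    IsChevalleyMap fun p : Pts Y => p ≫ f := by
  intro T hT hTi
  have hW : IsIrreducible (closure (pointOf '' T)) :=
    (hTi.image pointOf isInducing_pointOf.continuous.continuousOn).closure
  have hTW : pointOf ⁻¹' closure (pointOf '' T) = T := by
    rw [← isInducing_pointOf.closure_eq_preimage_closure_image, hT.closure_eq]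
  set W := closure (pointOf '' T)
  have hWc : IsClosed W := isClosed_closure
  obtain ⟨w, hw⟩ := QuasiSober.sober hW hWc
  have hw' : closure {w} = W := hw
  have hwW : w ∈ W := hw' ▸ subset_closure rfl
  obtain ⟨U, hU, hwU, hUW⟩ := (isConstructible_image_left f hWc).exists_isOpen_inter_closure_subset
    ⟨w, hwW, rfl⟩
  have hfW : f.left '' W ⊆ closure {f.left w} := by
    rw [← hw']
    refine (image_closure_subset_closure_image f.left.continuous).trans ?_
    rw [Set.image_singleton]
  refine ⟨pointOf ⁻¹' U, hU.preimage isInducing_pointOf.continuous, ?_, ?_⟩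
  · obtain ⟨p, hpU, hpW⟩ := exists_pointOf_mem
      ((hU.preimage f.left.continuous).isLocallyClosed.inter hWc.isLocallyClosed) ⟨w, hwU, hwW⟩
    refine ⟨p ≫ f, ?_, p, hTW.le hpW, rfl⟩
    rw [Set.mem_preimage, pointOf_comp]
    exact hpU
  · rintro p ⟨hpU, hp⟩
    have hp1 : pointOf p ∈ closure {f.left w} := by
      have h1 : closure ((fun p : Pts Y => p ≫ f) '' T) ⊆ pointOf ⁻¹' closure {f.left w} := by
        refine closure_minimal ?_ (isClosed_closure.preimage isInducing_pointOf.continuous)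
        rintro _ ⟨q, hq, rfl⟩
        rw [Set.mem_preimage, pointOf_comp]
        exact hfW ⟨_, hTW.ge hq, rfl⟩
      exact h1 hp
    obtain ⟨y, hyW, hy⟩ := hUW ⟨hpU, hp1⟩
    obtain ⟨q, hqW, hq⟩ := exists_pointOf_mem (hWc.isLocallyClosed.inter
      ((isClosed_singleton_pointOf p).preimage f.left.continuous).isLocallyClosed) ⟨y, hyW, hy⟩
    refine ⟨q, hTW.le hqW, pointOf_injective ?_⟩
    exact (pointOf_comp q f).trans hq

/-- A subset of `Z(K)` contained in the image of `Y(K)` has dimension at most `dim Y`. -/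
theorem topologicalKrullDim_le_of_subset_range [LocallyOfFiniteType Z.hom] [QuasiCompact Z.hom]
    (f : Y ⟶ Z) {I : Set (Pts Z)} (hI : I ⊆ Set.range fun p : Pts Y => p ≫ f) :
    topologicalKrullDim I ≤ topologicalKrullDim (Pts Y) := by
  rw [topologicalKrullDim_pts]
  refine iSup_le fun c => ?_
  have hj : IsInducing (fun p : I => pointOf (p : Pts Z)) :=
    isInducing_pointOf.comp IsInducing.subtypeVal
  let c' := c.map _ (IrreducibleCloseds.map_strictMono_of_isInducing hj)
  obtain ⟨η, hη⟩ := QuasiSober.sober c'.last.isIrreducible c'.last.isClosed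
  have hη' : closure {η} = c'.last.carrier := hη
  have hlast : c'.last.carrier = closure ((fun p : I => pointOf (p : Pts Z)) '' c.last) := rfl
  -- Otherwise the constructible complement of the image would contain a neighbourhood of `η` in its
  -- closure, and this neighbourhood contains points of `I`, which lie in the image.
  have hrange : η ∈ f.left '' Set.univ := by
    by_contra h
    obtain ⟨U, hU, hηU, hUr⟩ :=
      (isConstructible_image_left f isClosed_univ).compl.exists_isOpen_inter_closure_subset h
    have hηc : η ∈ closure ((fun p : I => pointOf (p : Pts Z)) '' c.last) := by
      rw [← hlast, ← hη']; exact subset_closure rfl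
    obtain ⟨_, hpU, p, hp, rfl⟩ := mem_closure_iff.mp hηc U hU hηU
    refine hUr ⟨hpU, ?_⟩ ?_
    · rw [hη', hlast]; exact subset_closure ⟨p, hp, rfl⟩
    · obtain ⟨q, hq⟩ := hI p.2
      exact ⟨pointOf q, trivial, (pointOf_comp q f).symm.trans (congrArg pointOf hq)⟩
  obtain ⟨y, -, hy⟩ := hrange
  exact length_le_topologicalKrullDim f c' (y := y) (by rw [hy, hη'])

end PointsTopology

/-! ### Consequences of a finite kernel -/

section NoetherianGroupKernels

open TopologicalSpace Topology

theorem IsIrreducible.exists_subset_of_subset_iUnion {B ι : Type*} [TopologicalSpace B] [Finite ι]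
    {Z : Set B} (hZ : IsIrreducible Z) {F : ι → Set B} (hF : ∀ i, IsClosed (F i))
    (hZF : Z ⊆ ⋃ i, F i) : ∃ i, Z ⊆ F i := by
  classical
  obtain ⟨_, ht, h⟩ := isIrreducible_iff_sUnion_isClosed.mp hZ (Set.finite_range F).toFinset
    (by simpa using hF) (by simpa [Set.sUnion_range] using hZF)
  obtain ⟨i, rfl⟩ : ∃ i, F i = _ := by simpa using ht
  exact ⟨i, h⟩

variable {B : Type*} [Group B] [TopologicalSpace B] [SeparatelyContinuousMul B]

/-- A closed set which meets every coset of a finite normal subgroup of the identity component is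
everything. -/
theorem IsClosed.eq_univ_of_forall_exists_mul_mem [NoetherianSpace B] {N : Subgroup B}
    [hn : N.Normal] [Finite N] (hN : N ≤ identityComponent B) {H : Set B} (hH : IsClosed H)
    (h : ∀ b, ∃ n ∈ N, n * b ∈ H) : H = Set.univ := by
  refine Set.eq_univ_of_forall fun x => ?_
  have hC : IsIrreducible (irreducibleComponent x) := isIrreducible_irreducibleComponent
  -- One set n⁻¹H contains the whole component of `x`. That component also contains n⁻¹x, because
  -- `N` is normal and inside the identity component; hence x ∈ H.
  obtain ⟨⟨n, hnN⟩, hxn⟩ := hC.exists_subset_of_subset_iUnion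
    (F := fun n : N => (fun b => (n : B) * b) ⁻¹' H)
    (fun n => hH.preimage (continuous_const_mul _))
    (fun b _ => by obtain ⟨n, hn, hb⟩ := h b; exact Set.mem_iUnion.mpr ⟨⟨n, hn⟩, hb⟩)
  have hmem : n⁻¹ * x ∈ irreducibleComponent x := by
    rw [← image_mul_identityComponent]
    refine ⟨x⁻¹ * n⁻¹ * x, hN ?_, by group⟩
    simpa using hn.conj_mem _ (N.inv_mem hnN) x⁻¹
  simpa using hxn hmem

variable {C : Type*} [Group C] [TopologicalSpace C]

/-- A homomorphism with finite kernel does not decrease the dimension. -/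
theorem topologicalKrullDim_le_range {φ : B →* C} (hφ : IsChevalleyMap φ) (hc : Continuous φ)
    [Finite φ.ker] : topologicalKrullDim B ≤ topologicalKrullDim (Set.range φ) := by
  have hr : Continuous (Set.rangeFactorization φ) := hc.subtype_mk _
  refine Order.krullDim_le_of_strictMono (IrreducibleCloseds.map _ hr) fun Z Z' hlt =>
    lt_of_le_of_ne (IrreducibleCloseds.map_mono hr hlt.le) fun heq => ?_
  have hcl : closure (φ '' Z) = closure (φ '' Z') := by
    have h1 : closure (Set.rangeFactorization φ '' Z) = closure (Set.rangeFactorization φ '' Z') :=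
      congrArg IrreducibleCloseds.carrier heq
    have h2 : ∀ T : Set B, closure (φ '' T) =
        closure (Subtype.val '' closure (Set.rangeFactorization φ '' T)) := by
      intro T
      rw [closure_image_closure continuous_subtype_val, Set.image_image]
      rfl
    rw [h2, h2, h1]
  obtain ⟨U, hU, ⟨_, hzU, z, hz, rfl⟩, hUZ⟩ := hφ Z Z.isClosed Z.isIrreducible
  -- On a dense open part of `Z'` the images lie in the image of `Z`, so this part is covered by
  -- kernel translates of `Z`, a finite union of closed sets.
  have hsub : (Z' : Set B) ⊆ ⋃ n : φ.ker, (fun b => (n : B) * b) ⁻¹' Z := by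
    refine (subset_closure_inter_of_isPreirreducible_of_isOpen Z'.isIrreducible.2
      (hU.preimage hc) ⟨z, hlt.le hz, hzU⟩).trans (closure_minimal ?_
      (isClosed_iUnion_of_finite fun n => Z.isClosed.preimage (continuous_const_mul _)))
    rintro w ⟨hw, hwU⟩
    obtain ⟨y, hy, hyw⟩ := hUZ ⟨hwU, hcl ▸ subset_closure ⟨w, hw, rfl⟩⟩
    refine Set.mem_iUnion.mpr ⟨⟨y * w⁻¹, ?_⟩, ?_⟩
    · simp [MonoidHom.mem_ker, hyw]
    · simpa using hy
  obtain ⟨n, hn⟩ := Z'.isIrreducible.exists_subset_of_subset_iUnion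
    (fun n => Z.isClosed.preimage (continuous_const_mul _)) hsub
  -- From nZ' ⊆ Z ⊆ Z' it follows that nZ ⊆ Z. As n has finite order, n⁻¹ is a power of n and maps
  -- nZ' ⊆ Z back into Z, so Z' ⊆ Z.
  have hpow : ∀ k : ℕ, ∀ b ∈ (Z : Set B), (n : B) ^ k * b ∈ (Z : Set B) := by
    intro k
    induction k with
    | zero => intro b hb; simpa using hb
    | succ k ih =>
      intro b hb
      rw [pow_succ, mul_assoc]
      exact ih _ (hn (hlt.le hb))
  have hinv : (n : B)⁻¹ = (n : B) ^ (orderOf n - 1) := by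
    have h1 : n ^ orderOf n = 1 := pow_orderOf_eq_one n
    have h2 : (n : B) ^ orderOf n = 1 := by rw [← Subgroup.coe_pow, h1, Subgroup.coe_one]
    rw [inv_eq_iff_mul_eq_one, ← pow_succ', Nat.sub_add_cancel (orderOf_pos n), h2]
  refine hlt.not_ge fun b hb => ?_
  have := hpow (orderOf n - 1) _ (hn hb)
  rw [← hinv] at this
  simpa using this

end NoetherianGroupKernels

/-! ### Reduction to a finite alphabet -/

section FiniteQuotientAlphabet

variable {G : Type v} [Group G] {A : Type u} [Group A] {M : Finset G}

/-- If the local map preserves a normal subgroup of finite index of the alphabet, then the kernel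
consists of configurations with values in that subgroup. -/
theorem apply_mem_of_caHom_eq_one [DecidableEq G] (hG : IsSofic G) (f : (M → A) →* A)
    {E : Finset G}
    (hE : ∀ a : A, ∃ z ∈ supportedOn A (E : Set G), caHom f z = Pi.mulSingle 1 a)
    {Q : Subgroup A} [Q.Normal] [Q.FiniteIndex] (hf : ∀ x, (∀ m, x m ∈ Q) → f x ∈ Q)
    {Ω : Finset G} {z : G → A} (hz : z ∈ supportedOn A (Ω : Set G)) (hz1 : caHom f z = 1) (g : G) :
    z g ∈ Q := by
  let π : (M → A) →* (M → A ⧸ Q) := MonoidHom.compLeft (QuotientGroup.mk' Q) M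
  have hπ : Function.Surjective π := fun y =>
    ⟨fun m => (y m).out, funext fun m => QuotientGroup.out_eq' (y m)⟩
  have hker : π.ker ≤ ((QuotientGroup.mk' Q).comp f).ker := by
    intro x hx
    rw [MonoidHom.mem_ker, MonoidHom.comp_apply, QuotientGroup.mk'_apply, QuotientGroup.eq_one_iff]
    refine hf x fun m => ?_
    rw [← QuotientGroup.eq_one_iff]
    exact congrFun (MonoidHom.mem_ker.mp hx) m
  let f' : (M → A ⧸ Q) →* A ⧸ Q := π.liftOfSurjective hπ ⟨_, hker⟩
  have hf' : ∀ x, f' (π x) = QuotientGroup.mk' Q (f x) := fun x =>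
    π.liftOfRightInverse_comp_apply _ _ ⟨_, hker⟩ x
  have hca : ∀ c : G → A, caHom f' (fun g => (c g : A ⧸ Q)) = fun g => (caHom f c g : A ⧸ Q) :=
    fun c => funext fun g => hf' fun m => c (g * m)
  have hsupp : ∀ {c : G → A} {S : Set G}, c ∈ supportedOn A S →
      (fun g => (c g : A ⧸ Q)) ∈ supportedOn (A ⧸ Q) S := by
    intro c S hc g hg
    simp [hc g hg]
  have hE' : ∀ a : A ⧸ Q, ∃ z ∈ supportedOn (A ⧸ Q) (E : Set G),
      caHom f' z = Pi.mulSingle 1 a := by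
    intro a
    obtain ⟨a, rfl⟩ := QuotientGroup.mk_surjective a
    obtain ⟨c, hc, hca'⟩ := hE a
    refine ⟨_, hsupp hc, ?_⟩
    rw [hca, hca']
    ext g
    by_cases hg : g = 1
    · subst hg; simp
    · simp [hg]
  -- Over the finite alphabet `A ⧸ Q` all subgroups are admissible and proper inclusions count as
  -- large, so the counting argument forces a trivial kernel.
  have hadm : IsAdmissibleClass f' (fun _ => True) (fun _ _ => True) := by
    constructor <;> simp
  have hcard := not_isLargeIndex_card_ker hG f' E hE' Ω (s := True) hadm
    (D := Nat.card (⊤ : Subgroup (A ⧸ Q))) fun k hk => hk.lt_card.le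
  have hone : Nat.card ((caHom f').ker ⊓ supportedOn (A ⧸ Q) (Ω : Set G) :
      Subgroup (G → A ⧸ Q)) = 1 := by
    by_contra h
    exact hcard (Or.inr ⟨trivial, h⟩)
  rw [Subgroup.card_eq_one] at hone
  have hmem : (fun g => (z g : A ⧸ Q)) ∈
      ((caHom f').ker ⊓ supportedOn (A ⧸ Q) (Ω : Set G) : Subgroup (G → A ⧸ Q)) := by
    refine Subgroup.mem_inf.mpr ⟨MonoidHom.mem_ker.mpr ?_, hsupp hz⟩
    rw [hca, hz1]
    rfl
  rw [hone, Subgroup.mem_bot] at hmem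
  exact (QuotientGroup.eq_one_iff _).mp (congrFun hmem g)

end FiniteQuotientAlphabet

/-! ### Regular maps between powers of `X(K)` -/

section RegularMaps

open TopologicalSpace Topology

theorem IsChevalleyMap.of_isHomeomorph {B C B' C' : Type*} [TopologicalSpace B]
    [TopologicalSpace C] [TopologicalSpace B'] [TopologicalSpace C'] {s : B → B'} {t : C → C'}
    {c : B' → C'} {φ : B → C} (hs : IsHomeomorph s) (ht : IsHomeomorph t) (hc : IsChevalleyMap c)
    (h : ∀ x, t (φ x) = c (s x)) : IsChevalleyMap φ := by
  intro Z hZ hZi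
  obtain ⟨U, hU, hne, hsub⟩ := hc (s '' Z) (hs.isClosedMap Z hZ)
    (hZi.image s hs.continuous.continuousOn)
  have himg : c '' (s '' Z) = t '' (φ '' Z) := by
    rw [Set.image_image, Set.image_image]
    exact Set.image_congr fun x _ => (h x).symm
  rw [himg] at hne hsub
  refine ⟨t ⁻¹' U, hU.preimage ht.continuous, ?_, ?_⟩
  · obtain ⟨_, hyU, y, hy, rfl⟩ := hne
    exact ⟨y, hyU, hy⟩
  · rintro y ⟨hyU, hy⟩
    obtain ⟨x, hx, hxy⟩ := hsub ⟨hyU, image_closure_subset_closure_image ht.continuous ⟨y, hy, rfl⟩⟩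
    exact ht.injective hxy ▸ hx

variable {K : Type u} [Field K]

attribute [local instance] ptsTopology zariskiTopology

variable {X : Over (Spec (.of K))}

theorem toPower_comp_π {ι : Type v} [Finite ι] (p : ι → Pts X) (i : ι) :
    toPower p ≫ Pi.π (fun _ : ι => X) i = p i := Pi.lift_π _ _

theorem bijective_toPower {ι : Type v} [Finite ι] :
    Function.Bijective (toPower (X := X) (ι := ι)) := by
  refine ⟨fun p q h => funext fun i => ?_, fun y => ⟨fun i => y ≫ Pi.π _ i, ?_⟩⟩
  · rw [← toPower_comp_π p, h, toPower_comp_π]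
  · exact Pi.hom_ext _ _ fun i => toPower_comp_π _ i

theorem isHomeomorph_toPower {ι : Type v} [Finite ι] :
    IsHomeomorph (toPower (X := X) (ι := ι)) := by
  have h : IsInducing (toPower (X := X) (ι := ι)) := ⟨by rw [induced_compose]; rfl⟩
  rw [isHomeomorph_iff_isEmbedding_surjective]
  exact ⟨⟨h, bijective_toPower.1⟩, bijective_toPower.2⟩

/-- A map to `X(K)` from a set which is identified by `s` with the `K`-points of `Y` is regular if
it is induced by a morphism `Y ⟶ X`. -/
def IsRegularFun {S : Type*} {Y : Over (Spec (.of K))} (s : S → Pts Y) (φ : S → Pts X) : Prop :=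
  ∃ g : Y ⟶ X, ∀ x, φ x = s x ≫ g

section

variable {S : Type*} {Y : Over (Spec (.of K))} {s : S → Pts Y}

theorem IsRegularFun.self : IsRegularFun (id : Pts X → Pts X) fun a => a := ⟨𝟙 X, fun _ => by simp⟩

theorem IsRegularFun.coord {ι : Type v} [Finite ι] (i : ι) :
    IsRegularFun toPower fun p : ι → Pts X => p i :=
  ⟨Pi.π _ i, fun p => (toPower_comp_π p i).symm⟩

theorem IsRegularFun.const (a : Pts X) : IsRegularFun s fun _ => a :=
  ⟨Over.homMk Y.hom ≫ a, fun x => by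
    rw [← Category.assoc, Over.mkIdTerminal.hom_ext (s x ≫ Over.homMk Y.hom) (𝟙 _),
      Category.id_comp]⟩

theorem IsRegularFun.comp_power {ι : Type v} [Finite ι] (f : power X ι ⟶ X) {φ : ι → S → Pts X}
    (h : ∀ i, IsRegularFun s (φ i)) : IsRegularFun s fun x => toPower (fun i => φ i x) ≫ f := by
  choose g hg using h
  have hx : ∀ x, toPower (fun i => φ i x) = s x ≫ Pi.lift g := fun x =>
    Pi.hom_ext _ _ fun i => by simp [hg]
  exact ⟨Pi.lift g ≫ f, fun x => by simp only [hx, Category.assoc]⟩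

theorem exists_hom_of_forall_isRegularFun {κ : Type v} [Finite κ] {φ : S → κ → Pts X}
    (h : ∀ k, IsRegularFun s fun x => φ x k) :
    ∃ g : Y ⟶ power X κ, ∀ x, toPower (φ x) = s x ≫ g := by
  choose g hg using h
  exact ⟨Pi.lift g, fun x => Pi.hom_ext _ _ fun i => by simp [hg]⟩

variable [GrpObj X]

theorem IsRegularFun.mul {φ ψ : S → Pts X} (hφ : IsRegularFun s φ) (hψ : IsRegularFun s ψ) :
    IsRegularFun s fun x => φ x * ψ x := by
  obtain ⟨g, hg⟩ := hφ
  obtain ⟨h, hh⟩ := hψ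
  exact ⟨g * h, fun x => by simp only [MonObj.comp_mul, hg, hh]⟩

theorem IsRegularFun.inv {φ : S → Pts X} (hφ : IsRegularFun s φ) :
    IsRegularFun s fun x => (φ x)⁻¹ := by
  obtain ⟨g, hg⟩ := hφ
  exact ⟨g⁻¹, fun x => by simp only [GrpObj.comp_inv, hg]⟩

end

section

variable {S : Type*} [TopologicalSpace S] {Y : Over (Spec (.of K))} {s : S → Pts Y}

theorem IsRegularFun.continuous (hs : IsHomeomorph s) {φ : S → Pts X} (h : IsRegularFun s φ) :
    Continuous φ := by
  obtain ⟨g, hg⟩ := h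
  rw [funext hg]
  exact (continuous_comp_right g).comp hs.continuous

/-- Continuity of the coordinates would not suffice, the Zariski topology on a power being finer in
general than the product topology; regular coordinates assemble into a morphism to the power. -/
theorem continuous_of_forall_isRegularFun (hs : IsHomeomorph s) {κ : Type v} [Finite κ]
    {φ : S → κ → Pts X} (h : ∀ k, IsRegularFun s fun x => φ x k) : Continuous φ := by
  obtain ⟨g, hg⟩ := exists_hom_of_forall_isRegularFun h
  rw [isHomeomorph_toPower.isInducing.continuous_iff, show toPower ∘ φ = _ from funext hg]
  exact (continuous_comp_right g).comp hs.continuous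

variable [IsAlgClosed K] [LocallyOfFiniteType X.hom] [QuasiCompact X.hom]
  [LocallyOfFiniteType Y.hom] [QuasiCompact Y.hom]

theorem IsRegularFun.isChevalleyMap (hs : IsHomeomorph s) {φ : S → Pts X} (h : IsRegularFun s φ) :
    IsChevalleyMap φ := by
  obtain ⟨g, hg⟩ := h
  exact .of_isHomeomorph hs .id (isChevalleyMap_comp_right g) hg

theorem isChevalleyMap_of_forall_isRegularFun (hs : IsHomeomorph s) {κ : Type v} [Finite κ]
    {φ : S → κ → Pts X} (h : ∀ k, IsRegularFun s fun x => φ x k) : IsChevalleyMap φ := by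
  obtain ⟨g, hg⟩ := exists_hom_of_forall_isRegularFun h
  exact .of_isHomeomorph hs isHomeomorph_toPower (isChevalleyMap_comp_right g) hg

theorem topologicalKrullDim_range_le (hs : IsHomeomorph s) {κ : Type v} [Finite κ]
    {φ : S → κ → Pts X} (h : ∀ k, IsRegularFun s fun x => φ x k) :
    topologicalKrullDim (Set.range φ) ≤ topologicalKrullDim S := by
  obtain ⟨g, hg⟩ := exists_hom_of_forall_isRegularFun h
  rw [hs.topologicalKrullDim_eq s]
  let I : Set (Pts (power X κ)) := toPower '' Set.range φ
  let j : Set.range φ → I := fun p => ⟨toPower p, p, p.2, rfl⟩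
  have hj : IsInducing j := by
    refine IsInducing.of_comp ?_ continuous_subtype_val
      (isHomeomorph_toPower.isInducing.comp IsInducing.subtypeVal)
    exact (isHomeomorph_toPower.continuous.comp continuous_subtype_val).subtype_mk _
  refine hj.topologicalKrullDim_le.trans (topologicalKrullDim_le_of_subset_range g ?_)
  rintro _ ⟨_, ⟨x, rfl⟩, rfl⟩
  exact ⟨s x, (hg x).symm⟩

end

section

variable [GrpObj X]

instance : SeparatelyContinuousMul (Pts X) where
  continuous_const_mul := (IsRegularFun.mul (.const _) .self).continuous .id
  continuous_mul_const := (IsRegularFun.mul .self (.const _)).continuous .id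

instance : ContinuousInv (Pts X) where
  continuous_inv := (IsRegularFun.inv .self).continuous .id

variable {ι : Type v} [Finite ι]

instance separatelyContinuousMul_power : SeparatelyContinuousMul (ι → Pts X) where
  continuous_const_mul := continuous_of_forall_isRegularFun isHomeomorph_toPower fun i =>
    .mul (.const _) (.coord i)
  continuous_mul_const := continuous_of_forall_isRegularFun isHomeomorph_toPower fun i =>
    .mul (.coord i) (.const _)

end

section

variable [IsAlgClosed K] [LocallyOfFiniteType X.hom] [QuasiCompact X.hom] {ι : Type v} [Finite ι]

instance : T1Space (Pts X) := t1Space_pts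

instance : NoetherianSpace (Pts X) := noetherianSpace_pts

instance noetherianSpace_power : NoetherianSpace (ι → Pts X) :=
  have : NoetherianSpace (Pts (power X ι)) := noetherianSpace_pts
  isHomeomorph_toPower.isInducing.noetherianSpace

end

end RegularMaps

/-! ### Finitely supported configurations -/

section Extension

variable {G : Type v} {A : Type u} [Group A]

/-- Extension of patterns by the neutral element, as a homomorphism. -/
noncomputable def extendHom (A : Type u) [Group A] (Ω : Finset G) : (Ω → A) →* (G → A) where
  toFun := extendByOne Ω
  map_one' := by ext g; by_cases hg : g ∈ Ω <;> simp [extendByOne, hg]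
  map_mul' a b := by ext g; by_cases hg : g ∈ Ω <;> simp [extendByOne, hg]

theorem extendHom_apply_of_mem {Ω : Finset G} (p : Ω → A) {g : G} (hg : g ∈ Ω) :
    extendHom A Ω p g = p ⟨g, hg⟩ := dif_pos hg

theorem extendHom_apply_of_notMem {Ω : Finset G} (p : Ω → A) {g : G} (hg : g ∉ Ω) :
    extendHom A Ω p g = 1 := dif_neg hg

theorem extendHom_mem_supportedOn {Ω : Finset G} (p : Ω → A) :
    extendHom A Ω p ∈ supportedOn A (Ω : Set G) :=
  fun _ hg => extendHom_apply_of_notMem p hg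

theorem extendHom_restrict {Ω : Finset G} {z : G → A} (hz : z ∈ supportedOn A (Ω : Set G)) :
    extendHom A Ω (fun i => z i) = z := by
  ext g
  by_cases hg : g ∈ Ω
  · rw [extendHom_apply_of_mem _ hg]
  · rw [extendHom_apply_of_notMem _ hg, hz g hg]

theorem extendHom_injective (Ω : Finset G) : Function.Injective (extendHom A Ω) := by
  intro p q h
  ext ⟨g, hg⟩
  rw [← extendHom_apply_of_mem p hg, h, extendHom_apply_of_mem q hg]

variable [Group G] {M : Finset G}

theorem caHom_mem_supportedOn [DecidableEq G] (f : (M → A) →* A) {Ω : Finset G} {z : G → A}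
    (hz : z ∈ supportedOn A (Ω : Set G)) :
    caHom f z ∈ supportedOn A ((Ω ×ˢ M).image fun x => x.1 * x.2⁻¹ : Finset G) := by
  intro g hg
  have : (fun m : M => z (g * m)) = 1 := by
    ext m
    refine hz _ fun h => hg ?_
    exact Finset.mem_image.mpr ⟨(g * m, m), Finset.mem_product.mpr ⟨h, m.2⟩, by simp⟩
  exact (congrArg f this).trans f.map_one

/-- The value of a configuration's image depends on the subgroup generated by the memory set
only. -/
theorem caHom_indicator (f : (M → A) →* A) (z : G → A) (Γ : Subgroup G) (hM : (M : Set G) ⊆ Γ)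
    [DecidablePred (· ∈ Γ)] :
    caHom f (fun g => if g ∈ Γ then z g else 1) = fun g => if g ∈ Γ then caHom f z g else 1 := by
  ext g
  have hmem : ∀ m : M, g * m ∈ Γ ↔ g ∈ Γ := fun m => Subgroup.mul_mem_cancel_right _ (hM m.2)
  change f (fun m : M => if g * m ∈ Γ then z (g * m) else 1) = _
  simp only [hmem]
  split_ifs
  · rfl
  · exact f.map_one

end Extension

/-! ### Post-surjective automata over algebraic groups -/

section AlgebraicGroupAutomata

open TopologicalSpace Topology

attribute [local instance] ptsTopology zariskiTopology

variable {K : Type u} [Field K] {X : Over (Spec (.of K))}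

/-- Over an uncountable algebraically closed field, if an increasing sequence of closed sets covers
the set of `K`-points, then one of them is everything. -/
theorem exists_eq_univ_of_iUnion_eq_univ_pts [IsAlgClosed K] [Uncountable K]
    [LocallyOfFiniteType X.hom] [QuasiCompact X.hom] {F : ℕ → Set (Pts X)}
    (hmono : Monotone F) (hF : ∀ n, IsClosed (F n)) (hFu : ⋃ n, F n = Set.univ) :
    ∃ n, F n = Set.univ := by
  have h : ∀ T ∈ irreducibleComponents (Pts X), ∃ n, T ⊆ F n := fun T hT =>
    hT.1.exists_subset_of_subset_iUnion_pts (isClosed_of_mem_irreducibleComponents T hT) hF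
      (hFu ▸ Set.subset_univ _)
  choose! n hn using h
  obtain ⟨N, hN⟩ := ((NoetherianSpace.finite_irreducibleComponents (α := Pts X)).image n).bddAbove
  refine ⟨N, Set.eq_univ_of_forall fun a => ?_⟩
  have ha := irreducibleComponent_mem_irreducibleComponents a
  exact hmono (hN ⟨_, ha, rfl⟩) (hn _ ha mem_irreducibleComponent)

variable [GrpObj X]

/-- The homomorphism of groups of `K`-points induced by a homomorphism of algebraic groups. -/
noncomputable def pointHom {ι : Type v} [Finite ι] (f : power X ι ⟶ X) (hf : IsAlgGroupHom f) :
    (ι → Pts X) →* Pts X :=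
  MonoidHom.mk' (fun p => toPower p ≫ f) fun a b => hf _ a b

theorem isRegularFun_mulSingle {ι : Type v} [DecidableEq ι] (i j : ι) :
    IsRegularFun id fun a : Pts X => (Pi.mulSingle i a : ι → Pts X) j := by
  by_cases h : j = i
  · subst h; simpa using IsRegularFun.self
  · simpa [h] using IsRegularFun.const _

theorem isRegularFun_caHom_extendHom {G : Type v} [Group G] {M : Finset G} {f : power X M ⟶ X}
    (hf : IsAlgGroupHom f) (Ω : Finset G) (g : G) :
    IsRegularFun toPower fun p => caHom (pointHom f hf) (extendHom (Pts X) Ω p) g := by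
  refine IsRegularFun.comp_power f (φ := fun m p => extendHom (Pts X) Ω p (g * m)) fun m => ?_
  by_cases h : g * m ∈ Ω
  · simpa only [extendHom_apply_of_mem _ h] using IsRegularFun.coord _
  · simpa only [extendHom_apply_of_notMem _ h] using IsRegularFun.const _

variable [LocallyOfFiniteType X.hom] [QuasiCompact X.hom] {ι : Type v} [Finite ι]

/-- Each coordinate embedding followed by `f` sends the identity component to an irreducible set
through 1, and `x` is a product of one-coordinate elements. -/
theorem pointHom_mem_identityComponent {f : power X ι ⟶ X}
    (hf : IsAlgGroupHom f) {x : ι → Pts X} (hx : ∀ m, x m ∈ identityComponent (Pts X)) :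
    pointHom f hf x ∈ identityComponent (Pts X) := by
  classical
  refine Subgroup.mem_comap.mp (Subgroup.pi_mem_of_mulSingle_mem x fun m => ?_)
  have hc : Continuous fun a : Pts X => pointHom f hf (Pi.mulSingle m a) :=
    (IsRegularFun.comp_power f fun j => isRegularFun_mulSingle m j).continuous .id
  exact (isIrreducible_identityComponent.image _ hc.continuousOn).subset_identityComponent
    ⟨1, (identityComponent (Pts X)).one_mem, by simp⟩ ⟨x m, hx m, rfl⟩

theorem mem_identityComponent_of_forall_mem {x : ι → Pts X}
    (hx : ∀ i, x i ∈ identityComponent (Pts X)) : x ∈ identityComponent (ι → Pts X) := by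
  classical
  refine Subgroup.pi_mem_of_mulSingle_mem x fun i => ?_
  have hc : Continuous fun a : Pts X => (Pi.mulSingle i a : ι → Pts X) :=
    continuous_of_forall_isRegularFun .id fun j => isRegularFun_mulSingle i j
  exact (isIrreducible_identityComponent.image _ hc.continuousOn).subset_identityComponent
    ⟨1, (identityComponent (Pts X)).one_mem, by simp⟩ ⟨x i, hx i, rfl⟩

variable [IsAlgClosed K] {G : Type v} {M : Finset G} {f : power X M ⟶ X} (hf : IsAlgGroupHom f)

/-- Zariski closed subgroups form an admissible class. -/
theorem isAdmissibleClass_isClosed :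
    IsAdmissibleClass (pointHom f hf) (fun P => IsClosed (P : Set (Pts X)))
      (fun n P => IsClosed (P : Set (Fin n → Pts X))) where
  bot := isClosed_singleton
  adm_sInf n S hS := by
    rw [Subgroup.coe_sInf]
    exact isClosed_biInter hS
  comap_graphHom n ψ P hP := by
    refine hP.preimage (continuous_of_forall_isRegularFun isHomeomorph_toPower fun k => ?_)
    exact IsRegularFun.comp_power f (φ := fun m (x : Fin n → Pts X) => x (ψ k m)) fun m => .coord _
  comap_eval n v P hP := hP.preimage ((IsRegularFun.coord v).continuous isHomeomorph_toPower)
  map_eval n v P hP :=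
    ((IsRegularFun.coord v).isChevalleyMap isHomeomorph_toPower).isClosed_map
      ((IsRegularFun.coord v).continuous isHomeomorph_toPower) hP

variable [Group G]

/-- If `τ` is post-surjective, then the preimages of the configurations supported at `1` can be
chosen with a common finite support. -/
theorem exists_finset_forall_caHom_eq_mulSingle [DecidableEq G] [Uncountable K]
    (hpost : PostSurjective (caHom (pointHom f hf))) :
    ∃ E : Finset G, ∀ a : Pts X, ∃ z ∈ supportedOn (Pts X) (E : Set G),
      caHom (pointHom f hf) z = Pi.mulSingle 1 a := by
  classical
  set T := caHom (pointHom f hf)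
  -- `G` may be uncountable, but cutting a preimage down to the subgroup generated by `M` leaves its
  -- image at the points of that subgroup unchanged, so countably many finite supports suffice.
  let Γ : Subgroup G := (FreeGroup.lift (Subtype.val : M → G)).range
  have hMΓ : (M : Set G) ⊆ Γ := fun m hm => ⟨FreeGroup.of ⟨m, hm⟩, by simp⟩
  have hΓ : Countable Γ := (MonoidHom.rangeRestrict_surjective (FreeGroup.lift _)).countable
  obtain ⟨e, he⟩ := exists_surjective_nat Γ
  let E : ℕ → Finset G := fun n => (Finset.range n).image fun i => (e i : G)
  have hEmono : Monotone E := fun a b hab => Finset.image_subset_image (Finset.range_mono hab)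
  let I : ℕ → Set (Pts X) := fun n =>
    {a | ∃ z ∈ supportedOn (Pts X) (E n : Set G), T z = Pi.mulSingle 1 a}
  have hImono : Monotone I := by
    rintro a b hab x ⟨z, hz, hzx⟩
    exact ⟨z, fun g hg => hz g fun h => hg (hEmono hab h), hzx⟩
  have hIclosed : ∀ n, IsClosed (I n) := by
    intro n
    let ev : G → (E n → Pts X) →* Pts X := fun g =>
      (Pi.evalMonoidHom (fun _ : G => Pts X) g).comp (T.comp (extendHom (Pts X) (E n)))
    have hev : ∀ g, IsRegularFun toPower (ev g) := isRegularFun_caHom_extendHom hf (E n)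
    -- The patterns whose image is trivial off 1 form a closed subgroup, and `I n` is its image
    -- under the homomorphism `ev 1`, hence closed.
    let P : Subgroup (E n → Pts X) := ⨅ g : {g : G // g ≠ 1}, (ev g).ker
    have hP : IsClosed (P : Set (E n → Pts X)) := by
      rw [Subgroup.coe_iInf]
      exact isClosed_iInter fun g =>
        (isClosed_singleton (x := (1 : Pts X))).preimage ((hev g).continuous isHomeomorph_toPower)
    have hIP : I n = P.map (ev 1) := by
      ext a
      constructor
      · rintro ⟨z, hz, hza⟩
        have hz' : T (extendHom (Pts X) (E n) fun i => z i) = Pi.mulSingle 1 a := by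
          rw [extendHom_restrict hz, hza]
        refine ⟨fun i => z i, ?_, ?_⟩
        · rw [SetLike.mem_coe, Subgroup.mem_iInf]
          intro g
          rw [MonoidHom.mem_ker]
          exact (congrFun hz' g).trans (Pi.mulSingle_eq_of_ne g.2 _)
        · exact (congrFun hz' 1).trans (Pi.mulSingle_eq_same _ _)
      · rintro ⟨p, hp, rfl⟩
        refine ⟨_, extendHom_mem_supportedOn p, ?_⟩
        refine funext fun g => ?_
        by_cases hg : g = 1
        · subst hg
          rw [Pi.mulSingle_eq_same]; rfl
        · rw [Pi.mulSingle_eq_of_ne hg]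
          exact (Subgroup.mem_iInf.mp hp) ⟨g, hg⟩
    rw [hIP]
    exact ((hev 1).isChevalleyMap isHomeomorph_toPower).isClosed_map
      ((hev 1).continuous isHomeomorph_toPower) hP
  have hIuniv : ⋃ n, I n = Set.univ := by
    refine Set.eq_univ_of_forall fun a => ?_
    obtain ⟨z, ⟨S, hS⟩, hz⟩ := hpost 1 (Pi.mulSingle 1 a) ⟨{1}, fun g hg => by
      rw [Pi.mulSingle_eq_of_ne (by simpa using hg)]
      exact (congrFun T.map_one g).symm⟩
    have hbound : ∃ n, ∀ g ∈ S, g ∈ Γ → g ∈ E n := by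
      have h1 : ∀ g : G, ∃ n, g ∈ Γ → g ∈ E n := by
        intro g
        by_cases hg : g ∈ Γ
        · obtain ⟨i, hi⟩ := he ⟨g, hg⟩
          exact ⟨i + 1, fun _ => Finset.mem_image.mpr ⟨i, by simp, by rw [hi]⟩⟩
        · exact ⟨0, fun h => absurd h hg⟩
      choose n hn using h1
      exact ⟨S.sup n, fun g hg hgΓ => hEmono (Finset.le_sup hg) (hn g hgΓ)⟩
    obtain ⟨n, hn⟩ := hbound
    refine Set.mem_iUnion.mpr ⟨n, fun g => if g ∈ Γ then z g else 1, ?_, ?_⟩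
    · intro g hg
      by_cases hgΓ : g ∈ Γ
      · have hgS : g ∉ S := fun h => hg (hn g h hgΓ)
        simpa [hgΓ] using hS g hgS
      · simp [hgΓ]
    · rw [caHom_indicator _ z Γ hMΓ]
      refine funext fun g => ?_
      change (if g ∈ Γ then T z g else 1) = _
      rw [hz]
      by_cases hg : g = 1
      · subst hg; simp [Γ.one_mem]
      · simp [hg]
  obtain ⟨n, hn⟩ := exists_eq_univ_of_iUnion_eq_univ_pts hImono hIclosed hIuniv
  exact ⟨E n, fun a => hn.ge (Set.mem_univ a)⟩

variable [Uncountable K]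

/-- The kernel of a post-surjective automaton on patterns with given finite support is finite. -/
theorem finite_ker_caHom_comp_extendHom (hG : IsSofic G)
    (hpost : PostSurjective (caHom (pointHom f hf))) (Ω : Finset G) :
    Finite ((caHom (pointHom f hf)).comp (extendHom (Pts X) Ω)).ker := by
  classical
  obtain ⟨E, hE⟩ := exists_finset_forall_caHom_eq_mulSingle hf hpost
  obtain ⟨D, hD⟩ := exists_topologicalKrullDim_pts_le (Y := X)
  -- With `s = False` only the value 0, which encodes infinity, is large.
  have hcard := not_isLargeIndex_card_ker hG (pointHom f hf) E hE Ω (s := False)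
    (isAdmissibleClass_isClosed hf) (D := D) fun k hk => by
      exact_mod_cast (hk.le_topologicalKrullDim isClosed_univ).trans hD
  have hne : Nat.card ((caHom (pointHom f hf)).ker ⊓ supportedOn (Pts X) (Ω : Set G) :
      Subgroup (G → Pts X)) ≠ 0 := fun h => hcard (Or.inl h)
  have := Nat.finite_of_card_ne_zero hne
  exact Finite.of_injective
    (fun p => (⟨extendHom (Pts X) Ω p, p.2, extendHom_mem_supportedOn _⟩ :
      ((caHom (pointHom f hf)).ker ⊓ supportedOn (Pts X) (Ω : Set G) : Subgroup (G → Pts X))))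
    fun p q h => Subtype.ext (extendHom_injective Ω (congrArg Subtype.val h))

/-- The quotient of the alphabet by its identity component is finite and inherits a local rule, so
the finite-alphabet case applies to the values of a kernel element. -/
theorem ker_caHom_comp_extendHom_le_identityComponent (hG : IsSofic G)
    (hpost : PostSurjective (caHom (pointHom f hf))) (Ω : Finset G) :
    ((caHom (pointHom f hf)).comp (extendHom (Pts X) Ω)).ker ≤
      identityComponent (Ω → Pts X) := by
  classical
  obtain ⟨E, hE⟩ := exists_finset_forall_caHom_eq_mulSingle hf hpost
  intro p hp
  refine mem_identityComponent_of_forall_mem fun i => ?_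
  have := apply_mem_of_caHom_eq_one hG (pointHom f hf) hE
    (fun x hx => pointHom_mem_identityComponent hf hx) (extendHom_mem_supportedOn p) hp i
  rwa [extendHom_apply_of_mem p i.2] at this

theorem oneBulletPreInjective_caHom (hG : IsSofic G)
    (hpost : PostSurjective (caHom (pointHom f hf))) :
    OneBulletPreInjective (X := X) (caHom (pointHom f hf)) := by
  rintro ⟨Ω, H, hH, hne, heq⟩
  have := finite_ker_caHom_comp_extendHom hf hG hpost Ω
  refine hne (IsClosed.eq_univ_of_forall_exists_mul_mem
    (ker_caHom_comp_extendHom_le_identityComponent hf hG hpost Ω) hH fun b => ?_)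
  obtain ⟨_, ⟨h, hhH, rfl⟩, hh⟩ := heq.le ⟨_, ⟨b, trivial, rfl⟩, rfl⟩
  refine ⟨h * b⁻¹, ?_, by simpa using hhH⟩
  have hh' : caHom (pointHom f hf) (extendHom (Pts X) Ω h) =
    caHom (pointHom f hf) (extendHom (Pts X) Ω b) := hh
  simp [MonoidHom.mem_ker, hh']

theorem twoBulletPreInjective_caHom (hG : IsSofic G)
    (hpost : PostSurjective (caHom (pointHom f hf))) :
    TwoBulletPreInjective (X := X) (caHom (pointHom f hf)) := by
  classical
  intro Ω
  set T := caHom (pointHom f hf)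
  refine ⟨⟨(Ω ×ˢ M).image fun x => x.1 * x.2⁻¹, ?_⟩, fun F hF => ?_⟩
  · rintro _ ⟨_, ⟨p, -, rfl⟩, rfl⟩
    have h : T (extendHom (Pts X) Ω p) ∈ supportedOn _ _ :=
      caHom_mem_supportedOn _ (extendHom_mem_supportedOn p)
    exact ⟨fun i => T (extendHom (Pts X) Ω p) i, extendHom_restrict h⟩
  let φ : (Ω → Pts X) →* (F → Pts X) :=
    MonoidHom.pi fun g =>
      (Pi.evalMonoidHom (fun _ : G => Pts X) g).comp (T.comp (extendHom (Pts X) Ω))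
  have hφ : ∀ p, extendHom (Pts X) F (φ p) = T (extendHom (Pts X) Ω p) := by
    intro p
    obtain ⟨q, hq⟩ := hF ⟨_, ⟨p, trivial, rfl⟩, rfl⟩
    have hq' : extendHom (Pts X) F q = T (extendHom (Pts X) Ω p) := hq
    have h : T (extendHom (Pts X) Ω p) ∈ supportedOn (Pts X) (F : Set G) :=
      hq' ▸ extendHom_mem_supportedOn q
    exact extendHom_restrict h
  have hrange : {p : F → Pts X | extendByOne F p ∈ T '' (extendByOne Ω '' Set.univ)} =
      Set.range φ := by
    ext p
    constructor
    · rintro ⟨_, ⟨q, -, rfl⟩, hq⟩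
      exact ⟨q, extendHom_injective F ((hφ q).trans hq)⟩
    · rintro ⟨q, rfl⟩
      exact ⟨_, ⟨q, trivial, rfl⟩, (hφ q).symm⟩
  have hker : φ.ker = (T.comp (extendHom (Pts X) Ω)).ker := by
    ext p
    rw [MonoidHom.mem_ker, MonoidHom.mem_ker, MonoidHom.comp_apply, ← hφ,
      map_eq_one_iff _ (extendHom_injective F)]
  have hfin := finite_ker_caHom_comp_extendHom hf hG hpost Ω
  rw [← hker] at hfin
  have hreg : ∀ k, IsRegularFun toPower fun p => φ p k := fun k =>
    isRegularFun_caHom_extendHom hf Ω k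
  rw [hrange]
  have huniv : zariskiDim (Set.univ : Set (Ω → Pts X)) = topologicalKrullDim (Ω → Pts X) :=
    IsHomeomorph.topologicalKrullDim_eq _ (Homeomorph.Set.univ _).isHomeomorph
  rw [huniv]
  exact (topologicalKrullDim_range_le isHomeomorph_toPower hreg).antisymm
    (topologicalKrullDim_le_range
      (isChevalleyMap_of_forall_isRegularFun isHomeomorph_toPower hreg)
      (continuous_of_forall_isRegularFun isHomeomorph_toPower hreg))

end AlgebraicGroupAutomata

theorem theorem6p1 {G : Type v} [Group G] (hG : IsSofic G)
    {K : Type u} [Field K] [IsAlgClosed K] [Uncountable K]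
    (X : Over (Spec (.of K))) [GrpObj X] [IsReduced X.left]
    [LocallyOfFiniteType X.hom] [QuasiCompact X.hom]
    (τ : (G → Pts X) → (G → Pts X)) (hτ : IsAlgGroupCA τ) (hpost : PostSurjective τ) :
    OneBulletPreInjective τ ∧ TwoBulletPreInjective τ := by
  obtain ⟨M, f, hf, hca⟩ := hτ
  have hT : τ = caHom (pointHom f hf) := by
    ext c g
    rw [hca c g]
    simp only [shift, inv_inv]
    rfl
  subst hT
  exact ⟨oneBulletPreInjective_caHom hf hG hpost, twoBulletPreInjective_caHom hf hG hpost⟩
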